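/- **Setting.** A directed hypergraph $H=(V,F,z)$ consists of a finite set $V$ of $n$ vertices, a finite set $F$ of $m$ hyperarcs, each hyperarc $f$ being a pair $(t(f),h(f))$ of nonempty (not necessarily disjoint) subsets of $V$, and weights $z_f\ge 0$. Its rank is $r=\max_{f\in F}(|h(f)|+|t(f)|)$. Put $C(f)=t(f)\times h(f)$ and $C(F)=\bigcup_{f\in F}C(f)$. **Algorithms.** $\mathrm{CoresetFinder}(H,\lambda)$: let $A^{uv}=\{f\in F:(u,v)\in C(f)\}$ and start with $S=\emptyset$; for each $(u,v)\in C(F)$, in some order, let $S^{uv}$ consist of the $\lambda$ heaviest hyperarcs of $A^{uv}\setminus S$ if $|A^{uv}\setminus S|\ge\lambda$ (ties are broken by a fixed total order on $F$), and let $S^{uv}=A^{uv}\setminus S$ otherwise; then replace $S$ by $S\cup S^{uv}$. Return $S$. $\mathrm{DH\text{-}Onestep}(H,\lambda)$: compute $S=\mathrm{CoresetFinder}(H,\lambda)$; keep every $f\in S$ with its weight; keep every $f\in F\setminus S$ independently with probability $1/2$, and double its weight if it is kept. Return the resulting hypergraph. $\mathrm{DH\text{-}Sparsify}(H,\varepsilon)$,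 with constants $C_1,C_3>0$: let $m^*=\frac{n^2}{\varepsilon^2}\log^3\frac n\varepsilon$, $T=\lceil\log_{4/3}(m/m^*)\rceil$, $\tilde H_0=H$ and $i=0$. Denote by $m_i$ the number of hyperarcs of $\tilde H_i$. While $i<T$ and $m_i\ge C_3m^*$, let $$\varepsilon_i=\frac{\varepsilon}{4\log_{4/3}^2(m_i/m^*)},\qquad \lambda_i=\left\lceil\frac{C_1\log^3 m_i}{\varepsilon_i^2}\right\rceil,\qquad \tilde H_{i+1}=\mathrm{DH\text{-}Onestep}(\tilde H_i,\lambda_i),$$ and increase $i$ by one. Return the last $\tilde H_i$. **Model.** The algorithm is run on a unit-cost random access machine with real arithmetic (including $\log$ and $\lceil\cdot\rceil$), fair coin tosses, linked lists, and a memory that contains the input and is otherwise blank. The hyperarcs are given in an arbitrary order, each with the lists of the vertices of its tail and of its head. The sets $A^{uv}$ are computed by running through all $f\in F$ and all $(u,v)\in C(f)$ and are stored as lists indexed by $(u,v)$; the set $S$ is stored by one mark bit per hyperarc; the $\lambda$ heaviest hyperarcs of a list are found with the median-of-medians selection algorithm of Blum, Floyd, Pratt, Rivest and Tarjan. The running time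 is the number of executed instructions. **Theorem.** There is an absolute constant $K>0$ such that, for every constant $C_1>0$ and every sufficiently large constant $C_3$ (depending only on $C_1$), the following holds. For every directed hypergraph $H$ with $n$ vertices, $m\ge1$ hyperarcs and rank $r$, for every input representation of $H$, and for every $\varepsilon\in(0,1)$, the running time of $\mathrm{DH\text{-}Sparsify}(H,\varepsilon)$ is at most $K\,r^2m$ with probability at least $1-\frac Kn$. In other words, $\mathrm{DH\text{-}Sparsify}(H,\varepsilon)$ runs in $O(r^2m)$ time with probability at least $1-O(1/n)$. -/

import Mathlib

/-! ## Directed hypergraphs -/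

/-- A weighted directed hypergraph `(V, F, z)`: `F` is a set of hyperarcs, a hyperarc is a pair
`(tail, head)` of nonempty (possibly intersecting) vertex sets, and `z` gives the nonnegative
weights. -/
structure DirectedHypergraph (V : Type) [DecidableEq V] where
  arcs : Finset (Finset V × Finset V)
  weight : Finset V × Finset V → ℝ
  tail_nonempty : ∀ f ∈ arcs, f.1.Nonempty
  head_nonempty : ∀ f ∈ arcs, f.2.Nonempty
  weight_nonneg : ∀ f ∈ arcs, 0 ≤ weight f

/-- The rank `max_{f ∈ F} (|h(f)| + |t(f)|)`. -/
def DirectedHypergraph.rank {V : Type} [DecidableEq V] (H : DirectedHypergraph V) : ℕ :=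
  H.arcs.sup fun f => f.2.card + f.1.card

/-- An input representation of `H`: the `m` hyperarcs are labelled `0, …, m - 1` in an arbitrary
order (which also is the order used for breaking ties), and the tail and the head of every hyperarc
are given as lists, in an arbitrary order and without repetitions. -/
structure DirectedHypergraph.Representation {V : Type} [DecidableEq V]
    (H : DirectedHypergraph V) where
  arc : Fin H.arcs.card ≃ {f // f ∈ H.arcs}
  tail : Fin H.arcs.card → List V
  head : Fin H.arcs.card → List V
  tail_nodup : ∀ i, (tail i).Nodup
  head_nodup : ∀ i, (head i).Nodup
  tail_toFinset : ∀ i, (tail i).toFinset = (arc i).1.1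
  head_toFinset : ∀ i, (head i).toFinset = (arc i).1.2

/-! ## The machine: a unit-cost random access machine with real arithmetic and fair coins

A word holds a truth value, a natural number, a real number, a vertex, the label of a hyperarc, or a
pointer to an immutable linked list. -/

/-- The memory: for each hyperarc, its tail and head (as lists), its current weight and one mark
bit; for each pair of vertices, a list of hyperarcs. -/
structure Mem (V : Type) (m : ℕ) where
  tail : Fin m → List V
  head : Fin m → List V
  weight : Fin m → ℝ
  mark : Fin m → Bool
  bucket : V → V → List (Fin m)

/-- The instructions; the index is the type of the result. -/
inductive Instr (V : Type) (m : ℕ) : Type → Type 1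
  /-- one control step: enter a procedure or the next round of a loop, and inspect the first cell of
  the list (or the loop counter) that controls it -/
  | step : Instr V m Unit
  /-- toss a fair coin -/
  | coin : Instr V m Bool
  /-- list cells -/
  | isNil {α : Type} (l : List α) : Instr V m Bool
  | cons {α : Type} (a : α) (l : List α) : Instr V m (List α)
  /-- memory access -/
  | loadTail (f : Fin m) : Instr V m (List V)
  | loadHead (f : Fin m) : Instr V m (List V)
  | loadWeight (f : Fin m) : Instr V m ℝ
  | storeWeight (f : Fin m) (x : ℝ) : Instr V m Unit
  | loadMark (f : Fin m) : Instr V m Bool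
  | storeMark (f : Fin m) (b : Bool) : Instr V m Unit
  | loadBucket (u v : V) : Instr V m (List (Fin m))
  | storeBucket (u v : V) (l : List (Fin m)) : Instr V m Unit
  /-- comparison of labels of hyperarcs -/
  | arcLt (f g : Fin m) : Instr V m Bool
  /-- arithmetic of natural numbers -/
  | natAdd (a b : ℕ) : Instr V m ℕ
  | natSub (a b : ℕ) : Instr V m ℕ
  | natDiv (a b : ℕ) : Instr V m ℕ
  | natLt (a b : ℕ) : Instr V m Bool
  | natEq (a b : ℕ) : Instr V m Bool
  /-- arithmetic of real numbers -/
  | natCast (a : ℕ) : Instr V m ℝ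
  | realMul (x y : ℝ) : Instr V m ℝ
  | realDiv (x y : ℝ) : Instr V m ℝ
  | realLog (x : ℝ) : Instr V m ℝ
  | realLt (x y : ℝ) : Instr V m Bool
  | realLe (x y : ℝ) : Instr V m Bool
  | realCeil (x : ℝ) : Instr V m ℕ

/-- The effect of one instruction: the law of its result and of the new memory. -/
noncomputable def Instr.exec {V : Type} [DecidableEq V] {m : ℕ} {α : Type} :
    Instr V m α → Mem V m → PMF (α × Mem V m)
  | .step, s => PMF.pure ((), s)
  | .coin, s => (PMF.uniformOfFintype Bool).map fun b => (b, s)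
  | .isNil l, s => PMF.pure (l.isEmpty, s)
  | .cons a l, s => PMF.pure (a :: l, s)
  | .loadTail f, s => PMF.pure (s.tail f, s)
  | .loadHead f, s => PMF.pure (s.head f, s)
  | .loadWeight f, s => PMF.pure (s.weight f, s)
  | .storeWeight f x, s => PMF.pure ((), { s with weight := Function.update s.weight f x })
  | .loadMark f, s => PMF.pure (s.mark f, s)
  | .storeMark f b, s => PMF.pure ((), { s with mark := Function.update s.mark f b })
  | .loadBucket u v, s => PMF.pure (s.bucket u v, s)
  | .storeBucket u v l, s =>
      PMF.pure ((), { s with bucket := Function.update s.bucket u (Function.update (s.bucket u) v l) })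
  | .arcLt f g, s => PMF.pure (decide (f < g), s)
  | .natAdd a b, s => PMF.pure (a + b, s)
  | .natSub a b, s => PMF.pure (a - b, s)
  | .natDiv a b, s => PMF.pure (a / b, s)
  | .natLt a b, s => PMF.pure (decide (a < b), s)
  | .natEq a b, s => PMF.pure (decide (a = b), s)
  | .natCast a, s => PMF.pure ((a : ℝ), s)
  | .realMul x y, s => PMF.pure (x * y, s)
  | .realDiv x y, s => PMF.pure (x / y, s)
  | .realLog x, s => PMF.pure (Real.log x, s)
  | .realLt x y, s => PMF.pure (decide (x < y), s)
  | .realLe x y, s => PMF.pure (decide (x ≤ y), s)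
  | .realCeil x, s => PMF.pure (⌈x⌉₊, s)

/-- Programs with a result in `α`: stop with a result, or execute one instruction and continue
according to its result. -/
inductive Prog (V : Type) (m : ℕ) (α : Type) : Type 1
  | ret (a : α) : Prog V m α
  | exec {β : Type} (i : Instr V m β) (k : β → Prog V m α) : Prog V m α

namespace Prog

/-- Sequential composition. -/
def bind {V : Type} {m : ℕ} {α β : Type} : Prog V m α → (α → Prog V m β) → Prog V m β
  | ret a, f => f a
  | exec i k, f => exec i fun b => bind (k b) f

instance {V : Type} {m : ℕ} : Monad (Prog V m) where
  pure := ret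
  bind := bind

/-- The joint law of the result, the final memory, and the running time of a program started on a
given memory. The running time is the number of executed instructions. -/
noncomputable def run {V : Type} [DecidableEq V] {m : ℕ} {α : Type} :
    Prog V m α → Mem V m → PMF (α × Mem V m × ℕ)
  | ret a, s => PMF.pure (a, s, 0)
  | exec i k, s => (i.exec s).bind fun p =>
      (run (k p.1) p.2).map fun q => (q.1, q.2.1, q.2.2 + 1)

end Prog

/-- The program consisting of a single instruction. -/
def instr {V : Type} {m : ℕ} {α : Type} (i : Instr V m α) : Prog V m α :=
  .exec i .ret

/-! ## Linear-time selection (median of medians of groups of five) -/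

section Selection

variable {V : Type} {m : ℕ}

/-- The length of a list. -/
def lengthP {α : Type} : List α → Prog V m ℕ
  | [] => do
      instr .step
      return 0
  | _ :: l => do
      instr .step
      let k ← lengthP l
      instr (.natAdd k 1)

/-- Is `f` heavier than `g`? Ties are broken by the labels. -/
def heavier (f g : Fin m) : Prog V m Bool := do
  let x ← instr (.loadWeight f)
  let y ← instr (.loadWeight g)
  if (← instr (.realLt y x)) then
    return true
  else if (← instr (.realLt x y)) then
    return false
  else
    instr (.arcLt f g)

/-- Insert `f` into a list sorted from heavy to light. -/
def insertP (f : Fin m) : List (Fin m) → Prog V m (List (Fin m))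
  | [] => do
      instr .step
      instr (.cons f [])
  | g :: l => do
      instr .step
      if (← heavier f g) then
        instr (.cons f (g :: l))
      else
        let l' ← insertP f l
        instr (.cons g l')

/-- Insertion sort, from heavy to light; only used on lists of bounded length. -/
def sortP : List (Fin m) → Prog V m (List (Fin m))
  | [] => do
      instr .step
      return []
  | f :: l => do
      instr .step
      let l' ← sortP l
      insertP f l'

/-- The entry at position `k` (counted from `0`) of a list, or `d` if there is none. -/
def nthP (d : Fin m) : ℕ → List (Fin m) → Prog V m (Fin m)
  | _, [] => do
      instr .step
      return d
  | 0, f :: _ => do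
      instr .step
      return f
  | k + 1, _ :: l => do
      instr .step
      nthP d k l

/-- The medians of the consecutive groups of five (an incomplete last group is ignored). -/
def mediansP : List (Fin m) → Prog V m (List (Fin m))
  | a :: b :: c :: d :: e :: l => do
      instr .step
      -- make the group a list of its own
      let g₁ ← instr (.cons e [])
      let g₂ ← instr (.cons d g₁)
      let g₃ ← instr (.cons c g₂)
      let g₄ ← instr (.cons b g₃)
      let g₅ ← instr (.cons a g₄)
      let g ← sortP g₅
      let p ← nthP a 2 g
      let ps ← mediansP l
      instr (.cons p ps)
  | _ => do
      instr .step
      return []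

/-- The members of a list that are heavier than `p`, and those that are lighter than `p`. -/
def splitP (p : Fin m) : List (Fin m) → Prog V m (List (Fin m) × List (Fin m))
  | [] => do
      instr .step
      return ([], [])
  | f :: l => do
      instr .step
      let AB ← splitP p l
      if (← heavier f p) then
        let A ← instr (.cons f AB.1)
        return (A, AB.2)
      else if (← heavier p f) then
        let B ← instr (.cons f AB.2)
        return (AB.1, B)
      else
        return AB

/-- The selection algorithm of Blum, Floyd, Pratt, Rivest and Tarjan: the hyperarc at position `k`
(counted from `0`) of `L` in the order from heavy to light. The first argument is not seen by the
machine, it only bounds the depth of the recursion: every recursive call is on a shorter list, so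
that the length of `L` is enough. The hyperarc `d` is a default value that is never used if
`k < L.length`. -/
def selectP : ℕ → Fin m → ℕ → List (Fin m) → Prog V m (Fin m)
  | 0, d, _, _ => do
      instr .step
      return d
  | fuel + 1, d, k, L => do
      instr .step
      let N ← lengthP L
      if (← instr (.natLt N 50)) then
        let L' ← sortP L
        nthP d k L'
      else
        let M ← mediansP L
        let g ← lengthP M
        let h ← instr (.natDiv g 2)
        let p ← selectP fuel d h M
        let AB ← splitP p L
        let a ← lengthP AB.1
        if (← instr (.natLt k a)) then
          selectP fuel d k AB.1
        else if (← instr (.natEq k a)) then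
          return p
        else
          let a' ← instr (.natAdd a 1)
          let k' ← instr (.natSub k a')
          selectP fuel d k' AB.2

/-- The members of a list that are not lighter than `p`. -/
def notLighterP (p : Fin m) : List (Fin m) → Prog V m (List (Fin m))
  | [] => do
      instr .step
      return []
  | f :: l => do
      instr .step
      let A ← notLighterP p l
      if (← heavier p f) then
        return A
      else
        instr (.cons f A)

/-- The `k` heaviest members of `L`, where `k ≤ L.length`. -/
def heaviestP (k : ℕ) : List (Fin m) → Prog V m (List (Fin m))
  | [] => do
      instr .step
      return []
  | d :: l => do
      instr .step
      if (← instr (.natEq k 0)) then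
        return []
      else
        let k' ← instr (.natSub k 1)
        let p ← selectP (d :: l).length d k' (d :: l)
        notLighterP p (d :: l)

end Selection

/-! ## CoresetFinder

The set `S` is represented by the mark bits, the set `A^{uv}` by the bucket of `(u, v)`. -/

section Coreset

variable {V : Type} {m : ℕ}

/-- Put `f` into `A^{uv}` for a given `u` and all `v` in a list. `P` is the list of the pairs
`(u, v)` whose set `A^{uv}` is nonempty so far. -/
def fillHeadP (f : Fin m) (u : V) : List V → List (V × V) → Prog V m (List (V × V))
  | [], P => do
      instr .step
      return P
  | v :: vs, P => do
      instr .step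
      let A ← instr (.loadBucket u v)
      let A' ← instr (.cons f A)
      instr (.storeBucket u v A')
      if (← instr (.isNil A)) then
        let P' ← instr (.cons (u, v) P)
        fillHeadP f u vs P'
      else
        fillHeadP f u vs P

/-- Put `f` into `A^{uv}` for all `u` in a list and all `v` in the list `hd`. -/
def fillTailP (f : Fin m) (hd : List V) : List V → List (V × V) → Prog V m (List (V × V))
  | [], P => do
      instr .step
      return P
  | u :: us, P => do
      instr .step
      let P' ← fillHeadP f u hd P
      fillTailP f hd us P'

/-- Compute `A^{uv} = {f ∈ F | (u, v) ∈ C(f)}` for all `(u, v) ∈ C(F)`, where all buckets are empty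
at the start, and return a list of the elements of `C(F)`. -/
def fillP : List (Fin m) → List (V × V) → Prog V m (List (V × V))
  | [], P => do
      instr .step
      return P
  | f :: fs, P => do
      instr .step
      let tl ← instr (.loadTail f)
      let hd ← instr (.loadHead f)
      let P' ← fillTailP f hd tl P
      fillP fs P'

/-- `A \ S`. -/
def unmarkedP : List (Fin m) → Prog V m (List (Fin m))
  | [] => do
      instr .step
      return []
  | f :: l => do
      instr .step
      let B ← unmarkedP l
      if (← instr (.loadMark f)) then
        return B
      else
        instr (.cons f B)

/-- Add all members of a list to `S`. -/
def markP : List (Fin m) → Prog V m Unit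
  | [] => do
      instr .step
      return ()
  | f :: l => do
      instr .step
      instr (.storeMark f true)
      markP l

/-- The main loop of the coreset construction, over the pairs `(u, v) ∈ C(F)`: if
`|A^{uv} \ S| ≥ lam`, then `S^{uv}` consists of the `lam` heaviest members of `A^{uv} \ S`, else
`S^{uv} = A^{uv} \ S`; then `S ← S ∪ S^{uv}`. The bucket is emptied for later use. -/
def pairsP (lam : ℕ) : List (V × V) → Prog V m Unit
  | [] => do
      instr .step
      return ()
  | uv :: P => do
      instr .step
      let A ← instr (.loadBucket uv.1 uv.2)
      instr (.storeBucket uv.1 uv.2 [])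
      let B ← unmarkedP A
      let N ← lengthP B
      if (← instr (.natLt N lam)) then
        markP B
      else
        let Suv ← heaviestP lam B
        markP Suv
      pairsP lam P

/-- CoresetFinder for the sub-hypergraph with hyperarcs `F` (and the current weights): mark the
hyperarcs of the coreset `S`. All marks are unset at the start. -/
def coresetFinder (lam : ℕ) (F : List (Fin m)) : Prog V m Unit := do
  let P ← fillP F []
  pairsP lam P

end Coreset

/-! ## DH-Onestep and DH-Sparsify -/

section Sparsify

variable {V : Type} {m : ℕ}

/-- Keep the members of `S` (and unset their marks); keep each of the other hyperarcs with
probability `1/2`, independently, and double its weight if it is kept. -/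
def sampleP : List (Fin m) → Prog V m (List (Fin m))
  | [] => do
      instr .step
      return []
  | f :: l => do
      instr .step
      if (← instr (.loadMark f)) then
        instr (.storeMark f false)
        let F' ← sampleP l
        instr (.cons f F')
      else if (← instr .coin) then
        let z ← instr (.loadWeight f)
        let z' ← instr (.realMul 2 z)
        instr (.storeWeight f z')
        let F' ← sampleP l
        instr (.cons f F')
      else
        sampleP l

/-- DH-Onestep. -/
def dhOnestep (lam : ℕ) (F : List (Fin m)) : Prog V m (List (Fin m)) := do
  coresetFinder lam F
  sampleP F

/-- `x ^ 3`. -/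
def cubeP (x : ℝ) : Prog V m ℝ := do
  let y ← instr (.realMul x x)
  instr (.realMul y x)

/-- `log_{4/3} (a / mstar)`. -/
noncomputable def logRatioP (a : ℕ) (mstar : ℝ) : Prog V m ℝ := do
  let x ← instr (.natCast a)
  let q ← instr (.realDiv x mstar)
  let l ← instr (.realLog q)
  let b ← instr (.realLog (4 / 3))
  instr (.realDiv l b)

/-- `m^* = (n² / ε²) log³ (n / ε)`. -/
def targetSizeP (n : ℕ) (ε : ℝ) : Prog V m ℝ := do
  let x ← instr (.natCast n)
  let q ← instr (.realDiv x ε)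
  let q2 ← instr (.realMul q q)
  let l ← instr (.realLog q)
  let l3 ← cubeP l
  instr (.realMul q2 l3)

/-- `λ_i = ⌈C₁ log³ m_i / ε_i²⌉` with `ε_i = ε / (4 log²_{4/3} (m_i / m^*))`. -/
noncomputable def lambdaP (C₁ ε mstar : ℝ) (mi : ℕ) : Prog V m ℕ := do
  let l ← logRatioP mi mstar
  let l2 ← instr (.realMul l l)
  let d ← instr (.realMul 4 l2)
  let εi ← instr (.realDiv ε d)
  let x ← instr (.natCast mi)
  let y ← instr (.realLog x)
  let y3 ← cubeP y
  let c ← instr (.realMul C₁ y3)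
  let e ← instr (.realMul εi εi)
  let w ← instr (.realDiv c e)
  instr (.realCeil w)

/-- The while loop of DH-Sparsify. The first argument is `T - i`; the loop is executed as long as
`i < T` and `m_i ≥ C₃ m^*`. -/
noncomputable def sparsifyLoop (C₁ C₃ ε mstar : ℝ) :
    ℕ → List (Fin m) → ℕ → Prog V m (List (Fin m))
  | 0, F, _ => do
      instr .step
      return F
  | k + 1, F, mi => do
      instr .step
      let x ← instr (.natCast mi)
      let y ← instr (.realMul C₃ mstar)
      if (← instr (.realLe y x)) then
        let lam ← lambdaP C₁ ε mstar mi
        let F' ← dhOnestep lam F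
        let mi' ← lengthP F'
        sparsifyLoop C₁ C₃ ε mstar k F' mi'
      else
        return F

/-- DH-Sparsify on a hypergraph with `n` vertices and hyperarcs `F`. The output hypergraph consists
of the returned hyperarcs with their final weights. -/
noncomputable def dhSparsify (C₁ C₃ : ℝ) (n : ℕ) (ε : ℝ) (F : List (Fin m)) :
    Prog V m (List (Fin m)) := do
  let m₀ ← lengthP F
  let mstar ← targetSizeP n ε
  let l ← logRatioP m₀ mstar
  let T ← instr (.realCeil l)
  sparsifyLoop C₁ C₃ ε mstar T F m₀

end Sparsify

/-- The memory at the start: the input, and otherwise blank. -/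
def DirectedHypergraph.Representation.initialMem {V : Type} [DecidableEq V]
    {H : DirectedHypergraph V} (R : H.Representation) : Mem V H.arcs.card where
  tail := R.tail
  head := R.head
  weight := fun i => H.weight (R.arc i).1
  mark := fun _ => false
  bucket := fun _ _ => []

/-- The law of the running time of DH-Sparsify with constants `C₁`, `C₃` on the represented
hypergraph and `ε`. -/
noncomputable def runningTime {V : Type} [Fintype V] [DecidableEq V] {H : DirectedHypergraph V}
    (R : H.Representation) (C₁ C₃ ε : ℝ) : PMF ℕ :=
  ((dhSparsify C₁ C₃ (Fintype.card V) ε (List.finRange H.arcs.card)).run R.initialMem).map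
    fun q => q.2.2

/-! ## Reasoning about programs -/

section Frame

variable {V : Type} [DecidableEq V] {m : ℕ} {α β : Type}

/-! Put `ρ = r²`. Every `C(f)` has at most `ρ` elements, so double counting bounds the total size of
the sets `A^{uv}` by `ρ·m_i`. Selection and all other list operations take linear time, so a round
of the loop on `m_i` hyperarcs costs `O(ρ·m_i)` whatever the coins show (`sat_selectP`,
`sum_bucket_length_le`, `sat_coresetFinder`). It remains to see that the `m_i` decrease
geometrically with high probability.

There are at most `n²` pairs and each adds at most `λ_i` hyperarcs to the coreset. If `m_i ≥ C₃
m^*`, then `8 n² λ_i ≤ m_i` for large `C₃`, because `n² λ_i` is `m^*` times a polylogarithm of `m_i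
/ m^*` up to constants and rounding (`exists_forall_coresetParameter_le`). Hence at least 7/8 of the
hyperarcs are subject to a coin toss. An exponential moment bound shows that more than `7 m_i / 8`
hyperarcs survive with probability at most `16 / m_i` (`ex_sampleP_indicator_le`).

While all rounds are good, the costs form a geometric series with sum `O(ρ·m)`. The failure
probabilities `16 / m_i` also form a geometric series, dominated by its last term, and every term is
at most `16 / (C₃ m^*)`; so they add up to at most `128 / (C₃ m^*) = O(1/n)`. `ex_sparsifyLoop_le`
carries out both summations in one induction, without using the value of `T`.

Two calculi are used: `Sat` for bounds that hold for every outcome, and `Ex` for expectations. Only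
the sampling step needs a genuine expectation; `ex_le_of_sat` passes from one calculus to the other.
-/

theorem Prog.run_bind (p : Prog V m α) (f : α → Prog V m β) (s : Mem V m) :
    (p >>= f).run s = (p.run s).bind fun q =>
      ((f q.1).run q.2.1).map fun q' => (q'.1, q'.2.1, q.2.2 + q'.2.2) := by
  change (Prog.bind p f).run s = _
  induction p generalizing s with
  | ret a =>
    simp only [Prog.bind, Prog.run, PMF.pure_bind, zero_add]
    exact (PMF.map_id _).symm
  | exec i k ih =>
    simp only [Prog.bind, Prog.run, PMF.bind_bind]
    congr 1
    funext x
    rw [ih, PMF.map_bind, PMF.bind_map]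
    congr 1
    funext q
    simp only [Function.comp_apply, PMF.map_comp]
    congr 1
    funext q'
    simp only [Function.comp_apply, Prod.mk.injEq, true_and]
    omega

theorem Prog.run_instr (i : Instr V m α) (s : Mem V m) :
    (instr i).run s = (i.exec s).map fun x => (x.1, x.2, 1) := by
  simp only [instr, Prog.run, PMF.pure_map]
  rfl

/-- Every outcome of `p`, started on `s` at time `t`, satisfies `Q`. -/
def Sat (p : Prog V m α) (s : Mem V m) (t : ℕ) (Q : α → Mem V m → ℕ → Prop) : Prop :=
  ∀ q ∈ (p.run s).support, Q q.1 q.2.1 (t + q.2.2)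

@[simp] theorem sat_pure (a : α) (s : Mem V m) (t : ℕ) (Q : α → Mem V m → ℕ → Prop) :
    Sat (pure a) s t Q ↔ Q a s t := by
  change Sat (Prog.ret a) s t Q ↔ _
  simp [Sat, Prog.run]

-- The starting time is threaded through the assertion, so costs add up along a composition. With
-- the rules for single instructions and branches, this lets `simp` execute straight-line code
-- symbolically.
@[simp] theorem sat_bind (p : Prog V m α) (f : α → Prog V m β) (s : Mem V m) (t : ℕ)
    (Q : β → Mem V m → ℕ → Prop) :
    Sat (p >>= f) s t Q ↔ Sat p s t fun a s' t' => Sat (f a) s' t' Q := by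
  simp only [Sat, Prog.run_bind, PMF.mem_support_bind_iff, PMF.support_map, Set.mem_image]
  constructor
  · intro h q hq q' hq'
    rw [add_assoc]
    exact h (q'.1, q'.2.1, q.2.2 + q'.2.2) ⟨q, hq, q', hq', rfl⟩
  · rintro h _ ⟨q, hq, q', hq', rfl⟩
    simpa [add_assoc] using h q hq q' hq'

@[simp] theorem sat_instr (i : Instr V m α) (s : Mem V m) (t : ℕ)
    (Q : α → Mem V m → ℕ → Prop) :
    Sat (instr i) s t Q ↔ ∀ x ∈ (i.exec s).support, Q x.1 x.2 (t + 1) := by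
  simp only [Sat, Prog.run_instr, PMF.support_map, Set.forall_mem_image]

@[simp] theorem sat_ite (c : Prop) [Decidable c] (p q : Prog V m α) (s : Mem V m) (t : ℕ)
    (Q : α → Mem V m → ℕ → Prop) :
    Sat (if c then p else q) s t Q ↔ (c → Sat p s t Q) ∧ (¬c → Sat q s t Q) := by
  split_ifs with h <;> simp [h]

theorem Sat.mono {p : Prog V m α} {s : Mem V m} {t : ℕ} {Q Q' : α → Mem V m → ℕ → Prop}
    (h : Sat p s t Q) (hQ : ∀ a s' t', Q a s' t' → Q' a s' t') : Sat p s t Q' :=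
  fun q hq => hQ _ _ _ (h q hq)

end Frame

/-! ## The order from heavy to light -/

section Order

variable {m : ℕ}

/-- `f` precedes `g` in the order from heavy to light. -/
def Heavier (w : Fin m → ℝ) (f g : Fin m) : Prop := w g < w f ∨ w g = w f ∧ f < g

noncomputable instance (w : Fin m → ℝ) (f g : Fin m) : Decidable (Heavier w f g) :=
  Classical.propDecidable _

variable {w : Fin m → ℝ} {f g h : Fin m}

theorem Heavier.trans (h₁ : Heavier w f g) (h₂ : Heavier w g h) : Heavier w f h := by
  rcases h₁ with h₁ | ⟨h₁, h₁'⟩ <;> rcases h₂ with h₂ | ⟨h₂, h₂'⟩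
  · exact .inl (h₂.trans h₁)
  · exact .inl (h₂ ▸ h₁)
  · exact .inl (h₁ ▸ h₂)
  · exact .inr ⟨h₂.trans h₁, h₁'.trans h₂'⟩

theorem Heavier.irrefl (w : Fin m → ℝ) (f : Fin m) : ¬Heavier w f f := by simp [Heavier]

theorem Heavier.asymm (h₁ : Heavier w f g) : ¬Heavier w g f := fun h₂ =>
  Heavier.irrefl w f (h₁.trans h₂)

theorem heavier_trichotomy (w : Fin m → ℝ) (f g : Fin m) :
    Heavier w f g ∨ f = g ∨ Heavier w g f := by
  rcases lt_trichotomy (w f) (w g) with h | h | h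
  · exact .inr (.inr (.inl h))
  · rcases lt_trichotomy f g with h' | h' | h'
    · exact .inl (.inr ⟨h.symm, h'⟩)
    · exact .inr (.inl h')
    · exact .inr (.inr (.inr ⟨h, h'⟩))
  · exact .inl (.inl h)

theorem Heavier.of_not (h₁ : ¬Heavier w f g) (h₂ : f ≠ g) : Heavier w g f := by
  have := heavier_trichotomy w f g
  simp only [h₁, h₂, false_or] at this
  exact this

/-- The position of a member of a list without repetitions, counted from both ends. -/
theorem countP_heavier_add {L : List (Fin m)} (hL : L.Nodup) {p : Fin m} (hp : p ∈ L) :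
    L.countP (fun x => Heavier w x p) + 1 + L.countP (fun x => Heavier w p x) = L.length := by
  induction L with
  | nil => simp at hp
  | cons a L ih =>
    rw [List.nodup_cons] at hL
    rcases List.mem_cons.1 hp with rfl | hp
    · have h : ∀ L : List (Fin m), p ∉ L →
          L.countP (fun x => Heavier w x p) + L.countP (fun x => Heavier w p x) = L.length := by
        intro L hL
        induction L with
        | nil => rfl
        | cons b L ih =>
          simp only [List.mem_cons, not_or] at hL
          have := ih hL.2
          rcases heavier_trichotomy w p b with h | h | h
          · simp [h, h.asymm]; omega
          · exact absurd h hL.1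
          · simp [h, h.asymm]; omega
      have := h L hL.1
      simp [Heavier.irrefl]
      omega
    · have := ih hL.2 hp
      have hne : a ≠ p := fun h => hL.1 (h ▸ hp)
      rcases heavier_trichotomy w a p with h | h | h
      · simp [h, h.asymm]; omega
      · exact absurd h hne
      · simp [h, h.asymm]; omega

theorem countP_not_add (P : Fin m → Prop) [DecidablePred P] (L : List (Fin m)) :
    L.countP (fun x => P x) + L.countP (fun x => ¬P x) = L.length := by
  have := L.length_eq_countP_add_countP (fun x => decide (P x))
  simpa using this.symm

/-- The entry at position `k` of a sorted list has `k` predecessors. -/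
theorem countP_heavier_getElem {L : List (Fin m)} (hL : L.Pairwise (Heavier w)) {k : ℕ}
    (hk : k < L.length) : L.countP (fun x => Heavier w x L[k]) = k := by
  induction L generalizing k with
  | nil => simp at hk
  | cons a L ih =>
    rw [List.pairwise_cons] at hL
    cases k with
    | zero =>
      rw [List.countP_eq_zero]
      intro x hx
      rcases List.mem_cons.1 hx with rfl | hx
      · simp [Heavier.irrefl]
      · simpa using (hL.1 x hx).asymm
    | succ k =>
      have hk' : k < L.length := by simpa using hk
      have := ih hL.2 hk'
      simp [this, hL.1 _ (List.getElem_mem hk')]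

end Order

/-! ## Linear-time selection -/

section SelectionAnalysis

variable {V : Type} [DecidableEq V] {m : ℕ} {s : Mem V m} {t : ℕ}

/-! ### Results and costs of the list procedures used by selection. -/

@[simp] theorem sat_lengthP {α : Type} (l : List α) (Q : ℕ → Mem V m → ℕ → Prop) :
    Sat (lengthP l) s t Q ↔ Q l.length s (t + 2 * l.length + 1) := by
  induction l generalizing t Q with
  | nil => simp [lengthP, Instr.exec]
  | cons a l ih =>
    simp [lengthP, Instr.exec, ih]
    ring_nf

theorem sat_heavier {f g : Fin m} {Q : Bool → Mem V m → ℕ → Prop}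
    (h : ∀ t' ≤ t + 5, Q (decide (Heavier s.weight f g)) s t') : Sat (heavier f g) s t Q := by
  simp only [heavier, sat_bind, sat_instr, Instr.exec, PMF.mem_support_pure_iff, forall_eq,
    sat_ite, sat_pure, decide_eq_true_eq]
  refine ⟨fun h₁ => ?_, fun h₁ => ⟨fun h₂ => ?_, fun h₂ => ?_⟩⟩
  · have := h (t + 1 + 1 + 1) (by omega)
    rwa [decide_eq_true (show Heavier s.weight f g from Or.inl h₁)] at this
  · have := h (t + 1 + 1 + 1 + 1) (by omega)
    rwa [decide_eq_false (show ¬Heavier s.weight f g by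
      rintro (h' | h') <;> linarith)] at this
  · have := h (t + 1 + 1 + 1 + 1 + 1) (by omega)
    have e : s.weight g = s.weight f := le_antisymm (not_lt.1 h₂) (not_lt.1 h₁)
    simpa [Heavier, e] using this

theorem sat_insertP {f : Fin m} {l : List (Fin m)} {Q : List (Fin m) → Mem V m → ℕ → Prop}
    (hl : l.Pairwise (Heavier s.weight)) (hf : f ∉ l)
    (h : ∀ l' t', l'.Perm (f :: l) → l'.Pairwise (Heavier s.weight) →
      t' ≤ t + 7 * l.length + 2 → Q l' s t') : Sat (insertP f l) s t Q := by
  induction l generalizing t Q with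
  | nil =>
    simp only [insertP, sat_bind, sat_instr, Instr.exec, PMF.mem_support_pure_iff, forall_eq]
    exact h _ _ (List.Perm.refl _) (List.pairwise_singleton _ _) (by simp)
  | cons g l ih =>
    rw [List.pairwise_cons] at hl
    simp only [List.mem_cons, not_or] at hf
    simp only [insertP, sat_bind, sat_instr, Instr.exec, PMF.mem_support_pure_iff, forall_eq]
    refine sat_heavier fun t₁ ht₁ => ?_
    simp only [sat_ite, decide_eq_true_eq, sat_bind, sat_instr, Instr.exec,
      PMF.mem_support_pure_iff, forall_eq]
    refine ⟨fun hfg => ?_, fun hfg => ih hl.2 hf.2 fun l' t' hp hs ht' => ?_⟩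
    · refine h _ _ (List.Perm.refl _) ?_ (by simp; omega)
      simp only [List.pairwise_cons, List.mem_cons, forall_eq_or_imp]
      exact ⟨⟨hfg, fun x hx => hfg.trans (hl.1 x hx)⟩, hl⟩
    · refine h _ _ ((hp.cons g).trans (List.Perm.swap _ _ _)) ?_ (by simp; omega)
      rw [List.pairwise_cons]
      refine ⟨fun x hx => ?_, hs⟩
      rcases List.mem_cons.1 (hp.subset hx) with rfl | hx
      · exact Heavier.of_not hfg hf.1
      · exact hl.1 x hx

/-- The quadratic cost is harmless: sorting is applied only to groups of five and to lists with
fewer than 50 members. -/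
theorem sat_sortP {l : List (Fin m)} {Q : List (Fin m) → Mem V m → ℕ → Prop}
    (hl : l.Nodup)
    (h : ∀ l' t', l'.Perm l → l'.Pairwise (Heavier s.weight) →
      t' ≤ t + (7 * l.length + 3) * l.length + 1 → Q l' s t') : Sat (sortP l) s t Q := by
  induction l generalizing t Q with
  | nil =>
    simp only [sortP, sat_bind, sat_instr, Instr.exec, PMF.mem_support_pure_iff, forall_eq,
      sat_pure]
    exact h _ _ (List.Perm.refl _) List.Pairwise.nil (by simp)
  | cons f l ih =>
    rw [List.nodup_cons] at hl
    simp only [sortP, sat_bind, sat_instr, Instr.exec, PMF.mem_support_pure_iff, forall_eq]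
    refine ih hl.2 fun l₁ t₁ hp₁ hs₁ ht₁ => sat_insertP hs₁ (fun hf => hl.1 (hp₁.subset hf))
      fun l₂ t₂ hp₂ hs₂ ht₂ => h _ _ (hp₂.trans (hp₁.cons f)) hs₂ ?_
    rw [hp₁.length_eq] at ht₂
    simp only [List.length_cons]
    nlinarith

theorem sat_nthP {d : Fin m} {k : ℕ} {l : List (Fin m)} {Q : Fin m → Mem V m → ℕ → Prop}
    (hk : k < l.length) (h : ∀ t' ≤ t + l.length, Q l[k] s t') : Sat (nthP d k l) s t Q := by
  induction l generalizing t k with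
  | nil => simp at hk
  | cons f l ih =>
    cases k with
    | zero =>
      simp only [nthP, sat_bind, sat_instr, Instr.exec, PMF.mem_support_pure_iff, forall_eq,
        sat_pure]
      exact h _ (by simp)
    | succ k =>
      simp only [nthP, sat_bind, sat_instr, Instr.exec, PMF.mem_support_pure_iff, forall_eq]
      exact ih (by simpa using hk) fun t' ht' => h _ (by simp; omega)

theorem sat_splitP {p : Fin m} {l : List (Fin m)}
    {Q : List (Fin m) × List (Fin m) → Mem V m → ℕ → Prop}
    (h : ∀ t' ≤ t + 12 * l.length + 1,
      Q (l.filter (fun x => Heavier s.weight x p), l.filter (fun x => Heavier s.weight p x)) s t') :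
    Sat (splitP p l) s t Q := by
  induction l generalizing t Q with
  | nil =>
    simp only [splitP, sat_bind, sat_instr, Instr.exec, PMF.mem_support_pure_iff, forall_eq,
      sat_pure]
    exact h _ (by simp)
  | cons f l ih =>
    simp only [splitP, sat_bind, sat_instr, Instr.exec, PMF.mem_support_pure_iff, forall_eq]
    refine ih fun t₁ ht₁ => sat_heavier fun t₂ ht₂ => ?_
    simp only [sat_ite, decide_eq_true_eq, sat_bind, sat_instr, Instr.exec,
      PMF.mem_support_pure_iff, forall_eq, sat_pure]
    refine ⟨fun h₁ => ?_, fun h₁ => sat_heavier fun t₃ ht₃ => ?_⟩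
    · have := h (t₂ + 1) (by simp; omega)
      simpa [List.filter_cons, h₁, h₁.asymm] using this
    · simp only [decide_eq_true_eq]
      refine ⟨fun h₂ => ?_, fun h₂ => ?_⟩
      · have := h (t₃ + 1) (by simp; omega)
        simpa [List.filter_cons, h₁, h₂] using this
      · have := h t₃ (by simp; omega)
        simpa [List.filter_cons, h₁, h₂] using this

theorem sat_notLighterP {p : Fin m} {l : List (Fin m)} {Q : List (Fin m) → Mem V m → ℕ → Prop}
    (h : ∀ t' ≤ t + 7 * l.length + 1, Q (l.filter (fun x => ¬Heavier s.weight p x)) s t') :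
    Sat (notLighterP p l) s t Q := by
  induction l generalizing t Q with
  | nil =>
    simp only [notLighterP, sat_bind, sat_instr, Instr.exec, PMF.mem_support_pure_iff, forall_eq,
      sat_pure]
    exact h _ (by simp)
  | cons f l ih =>
    simp only [notLighterP, sat_bind, sat_instr, Instr.exec, PMF.mem_support_pure_iff, forall_eq]
    refine ih fun t₁ ht₁ => sat_heavier fun t₂ ht₂ => ?_
    simp only [sat_ite, decide_eq_true_eq, sat_instr, Instr.exec,
      PMF.mem_support_pure_iff, forall_eq, sat_pure]
    refine ⟨fun h₁ => ?_, fun h₁ => ?_⟩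
    · have := h t₂ (by simp; omega)
      simpa [List.filter_cons, h₁] using this
    · have := h (t₂ + 1) (by simp; omega)
      simpa [List.filter_cons, h₁] using this

/-- `M` consists of the medians of disjoint groups of five of the list `L`. -/
structure IsMedians (w : Fin m → ℝ) (L M : List (Fin m)) : Prop where
  length_eq : M.length = L.length / 5
  subperm : M.Subperm L
  not_heavier (q : Fin m) :
    3 * M.countP (fun x => ¬Heavier w x q) ≤ L.countP (fun x => ¬Heavier w x q)
  not_lighter (q : Fin m) :
    3 * M.countP (fun x => ¬Heavier w q x) ≤ L.countP (fun x => ¬Heavier w q x)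

/-- The two entries after the median are lighter than it, and the two before it are heavier; by
transitivity they lie on the same side of `q` as the median does. -/
theorem three_le_countP_of_median {w : Fin m → ℝ} {G : List (Fin m)}
    (hG : G.Pairwise (Heavier w)) (h5 : G.length = 5) (q : Fin m) :
    (¬Heavier w G[2] q → 3 ≤ G.countP fun x => ¬Heavier w x q) ∧
    (¬Heavier w q G[2] → 3 ≤ G.countP fun x => ¬Heavier w q x) := by
  match G, h5 with
  | [x₀, x₁, x₂, x₃, x₄], _ =>
    simp only [List.pairwise_cons, List.mem_cons, List.not_mem_nil, or_false, forall_eq_or_imp,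
      forall_eq] at hG
    obtain ⟨⟨-, h02, -, -⟩, ⟨h12, -, -⟩, ⟨h23, h24⟩, -⟩ := hG
    constructor
    · intro h
      have h : ¬Heavier w x₂ q := h
      have h3 : ¬Heavier w x₃ q := fun h' => h (h23.trans h')
      have h4 : ¬Heavier w x₄ q := fun h' => h (h24.trans h')
      simp [List.countP_cons, h, h3, h4]
      omega
    · intro h
      have h : ¬Heavier w q x₂ := h
      have h0 : ¬Heavier w q x₀ := fun h' => h (h'.trans h02)
      have h1 : ¬Heavier w q x₁ := fun h' => h (h'.trans h12)
      simp [List.countP_cons, h, h0, h1]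

/-- The counting inequalities of `IsMedians` are additive over groups, so each group contributes its
three witnesses separately. A group costs at most 203 instructions, which is covered by 41 per
member. -/
theorem sat_mediansP {L : List (Fin m)} {Q : List (Fin m) → Mem V m → ℕ → Prop} (hL : L.Nodup)
    (h : ∀ M t', IsMedians s.weight L M → t' ≤ t + 41 * L.length + 1 → Q M s t') :
    Sat (mediansP L) s t Q := by
  induction hn : L.length using Nat.strong_induction_on generalizing L t Q with
  | _ n ih =>
  match L, hL, h, hn with
  | a :: b :: c :: d :: e :: l, hL, h, hn =>
    rw [← List.singleton_append, ← List.singleton_append (l := c :: _),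
      ← List.singleton_append (l := d :: _), ← List.singleton_append (l := e :: _)] at hL
    have hL' : ([a, b, c, d, e] ++ l).Nodup := hL
    have hG := hL'.of_append_left
    simp only [mediansP, sat_bind, sat_instr, Instr.exec, PMF.mem_support_pure_iff, forall_eq]
    refine sat_sortP hG fun G t₁ hp₁ hs₁ ht₁ => ?_
    have h5 : G.length = 5 := hp₁.length_eq
    refine sat_nthP (by omega) fun t₂ ht₂ => ?_
    refine ih l.length (by simp at hn; omega) hL'.of_append_right (fun M t₃ hM ht₃ => ?_) rfl
    have hcount : ∀ P : Fin m → Bool,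
        (a :: b :: c :: d :: e :: l).countP P = G.countP P + l.countP P := by
      intro P
      rw [hp₁.countP_eq, ← List.countP_append]
      rfl
    refine h _ _ ⟨?_, ?_, fun q => ?_, fun q => ?_⟩ ?_
    · simp [hM.length_eq]
      omega
    · have h1 : [G[2]].Subperm [a, b, c, d, e] := by
        rw [List.singleton_subperm_iff]
        exact hp₁.subset (List.getElem_mem _)
      exact h1.append hM.subperm
    · rw [hcount, List.countP_cons]
      have h1 := (three_le_countP_of_median hs₁ h5 q).1
      have h2 := hM.not_heavier q
      split_ifs with h3
      · have := h1 (by simpa using h3); omega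
      · omega
    · rw [hcount, List.countP_cons]
      have h1 := (three_le_countP_of_median hs₁ h5 q).2
      have h2 := hM.not_lighter q
      split_ifs with h3
      · have := h1 (by simpa using h3); omega
      · omega
    · simp at ht₁ ⊢
      omega
  | [], _, h, _ | [_], _, h, _ | [_, _], _, h, _ | [_, _, _], _, h, _ | [_, _, _, _], _, h, _ =>
    simp only [mediansP, sat_bind, sat_instr, Instr.exec, PMF.mem_support_pure_iff, forall_eq,
      sat_pure]
    exact h _ _ ⟨by simp, List.nil_subperm, by simp, by simp⟩ (by simp; try omega)

/-- The pivot is the middle one of about `N/5` medians, so about `N/10` medians lie on either side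
of it (itself included), and each brings three members of `L`. Thus each part of the split has at
most about `7N/10` members, and the bound follows from `1/5 + 7/10 < 1`. -/
theorem sat_selectP {fuel : ℕ} {d : Fin m} {k : ℕ} {L : List (Fin m)}
    {Q : Fin m → Mem V m → ℕ → Prop} (hL : L.Nodup) (hk : k < L.length) (hfuel : L.length ≤ fuel)
    (h : ∀ p t', p ∈ L → L.countP (fun x => Heavier s.weight x p) = k →
      t' ≤ t + 1000 * L.length → Q p s t') :
    Sat (selectP fuel d k L) s t Q := by
  induction fuel generalizing d k L t Q with
  | zero => omega
  | succ fuel ih =>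
    simp only [selectP, sat_bind, sat_instr, Instr.exec, PMF.mem_support_pure_iff, forall_eq,
      sat_lengthP, sat_ite, decide_eq_true_eq, not_lt]
    refine ⟨fun hN => ?_, fun hN => ?_⟩
    · refine sat_sortP hL fun G t₁ hp hs ht₁ => ?_
      have hkG : k < G.length := hp.length_eq ▸ hk
      refine sat_nthP hkG fun t₂ ht₂ => h _ _ (hp.subset (List.getElem_mem _)) ?_ ?_
      · rw [← hp.countP_eq]
        exact countP_heavier_getElem hs hkG
      · rw [hp.length_eq] at ht₂
        nlinarith
    · refine sat_mediansP hL fun M t₁ hM ht₁ => ?_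
      have hMlen := hM.length_eq
      have hMn : M.Nodup := by
        obtain ⟨l, hp, hs⟩ := hM.subperm
        exact hp.nodup_iff.1 (hs.nodup hL)
      refine ih hMn (by omega) (by omega) fun p t₂ hp hcp ht₂ => ?_
      refine sat_splitP fun t₃ ht₃ => ?_
      have hpL : p ∈ L := hM.subperm.subset hp
      have h1 := countP_not_add (fun x => Heavier s.weight x p) L
      have h2 := countP_not_add (fun x => Heavier s.weight p x) L
      have h3 := countP_not_add (fun x => Heavier s.weight x p) M
      have h4 := countP_not_add (fun x => Heavier s.weight p x) M
      have h5 := hM.not_heavier p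
      have h6 := hM.not_lighter p
      have h7 := countP_heavier_add (w := s.weight) hMn hp
      have h8 := countP_heavier_add (w := s.weight) hL hpL
      simp only [← List.countP_eq_length_filter] at *
      -- With rounding, a part has at most `7N/10 + 6/5` members. The two recursive calls cost at
      -- most `900 N + 1200`, the rest less than `60 N` plus a small constant; `N ≥ 50` makes the
      -- total at most `1000 N`.
      refine ⟨fun hka => ?_, fun hka => ⟨fun hka' => ?_, fun hka' => ?_⟩⟩
      · refine ih (hL.filter _) (by rwa [← List.countP_eq_length_filter])
          (by rw [← List.countP_eq_length_filter]; omega) fun p' t₄ hp' hcp' ht₄ => h _ _ ?_ ?_ ?_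
        · exact (List.mem_filter.1 hp').1
        · rw [← hcp', List.countP_filter]
          refine List.countP_congr fun x _ => ?_
          have := (List.mem_filter.1 hp').2
          simp only [decide_eq_true_eq, Bool.and_eq_true] at this ⊢
          exact ⟨fun hx => ⟨hx, hx.trans this⟩, fun hx => hx.1⟩
        · rw [← List.countP_eq_length_filter] at ht₄
          omega
      · rw [sat_pure]
        refine h _ _ hpL hka'.symm ?_
        omega
      · refine ih (hL.filter _) (by rw [← List.countP_eq_length_filter]; omega)
          (by rw [← List.countP_eq_length_filter]; omega) fun p' t₄ hp' hcp' ht₄ => h _ _ ?_ ?_ ?_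
        · exact (List.mem_filter.1 hp').1
        · have hpp' := (List.mem_filter.1 hp').2
          have hp'L := (List.mem_filter.1 hp').1
          simp only [decide_eq_true_eq] at hpp'
          -- The rank of `p'` is transferred to `L` by counting from the light end: whatever is
          -- lighter than `p'` is lighter than the pivot, so this count is the same in `L` and in
          -- the part.
          have e1 : (L.filter fun x => Heavier s.weight p x).countP (fun x => Heavier s.weight p' x)
              = L.countP (fun x => Heavier s.weight p' x) := by
            rw [List.countP_filter]
            refine List.countP_congr fun x _ => ?_
            simp only [decide_eq_true_eq, Bool.and_eq_true]
            exact ⟨fun hx => hx.1, fun hx => ⟨hx, hpp'.trans hx⟩⟩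
          have e2 := countP_heavier_add (w := s.weight) (hL.filter
            (fun x => Heavier s.weight p x)) hp'
          have e3 := countP_heavier_add (w := s.weight) hL hp'L
          rw [← List.countP_eq_length_filter] at e2
          omega
        · rw [← List.countP_eq_length_filter] at ht₄
          omega

/-- The member at position `k - 1` has exactly `k - 1` heavier members, so it and those heavier than
it are `k` in number. Only this size, not the order itself, matters for the running time. -/
theorem sat_heaviestP {k : ℕ} {L : List (Fin m)} {Q : List (Fin m) → Mem V m → ℕ → Prop}
    (hL : L.Nodup) (hk : k ≤ L.length)
    (h : ∀ B t', B ⊆ L → B.length = k → t' ≤ t + 1010 * L.length + 1 → Q B s t') :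
    Sat (heaviestP k L) s t Q := by
  cases L with
  | nil =>
    simp only [heaviestP, sat_bind, sat_instr, Instr.exec, PMF.mem_support_pure_iff, forall_eq,
      sat_pure]
    exact h _ _ (by simp) (by simp at hk; simp [hk]) (by simp)
  | cons d l =>
    simp only [heaviestP, sat_bind, sat_instr, Instr.exec, PMF.mem_support_pure_iff, forall_eq,
      sat_pure, sat_ite, decide_eq_true_eq]
    refine ⟨fun h0 => h _ _ (by simp) (by simp [h0]) (by simp; omega), fun h0 => ?_⟩
    refine sat_selectP hL (by omega) le_rfl fun p t₁ hp hcp ht₁ => ?_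
    refine sat_notLighterP fun t₂ ht₂ => h _ _ (List.filter_subset_self _) ?_ ?_
    · have h1 := countP_not_add (fun x => Heavier s.weight p x) (d :: l)
      have h2 := countP_heavier_add (w := s.weight) hL hp
      rw [← List.countP_eq_length_filter]
      omega
    · simp only [List.length_cons] at *
      omega

end SelectionAnalysis

/-! ## CoresetFinder -/

section CoresetAnalysis

variable {V : Type} [DecidableEq V] {m : ℕ} {s : Mem V m} {t : ℕ}

omit [DecidableEq V] in
theorem Mem.ext_of_bucket {s s' : Mem V m} (ht : s.tail = s'.tail) (hh : s.head = s'.head)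
    (hw : s.weight = s'.weight) (hm : s.mark = s'.mark)
    (hb : ∀ u v, s.bucket u v = s'.bucket u v) : s = s' := by
  cases s
  cases s'
  simp_all only [Mem.mk.injEq, true_and]
  funext u v
  exact hb u v

/-- `P` lists the pairs whose bucket is nonempty. -/
def IsBucketIndex (b : V → V → List (Fin m)) (P : List (V × V)) : Prop :=
  P.Nodup ∧ ∀ x, x ∈ P ↔ b x.1 x.2 ≠ []

/-- The memory after `f` has been put into the buckets of all pairs in `us × vs`. -/
def Mem.addArc (s : Mem V m) (f : Fin m) (us vs : List V) : Mem V m :=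
  { s with bucket := fun u v => if u ∈ us ∧ v ∈ vs then f :: s.bucket u v else s.bucket u v }

/-- A pair enters the index exactly when its bucket was empty, so the index stays free of
repetitions. Distinctness of the vertices ensures that `f` is put only once into each bucket. -/
theorem sat_fillHeadP {f : Fin m} {u : V} {vs : List V} {P : List (V × V)}
    {Q : List (V × V) → Mem V m → ℕ → Prop} (hvs : vs.Nodup) (hP : IsBucketIndex s.bucket P)
    (h : ∀ P' t', IsBucketIndex (s.addArc f [u] vs).bucket P' → t' ≤ t + 6 * vs.length + 1 →
      Q P' (s.addArc f [u] vs) t') :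
    Sat (fillHeadP f u vs P) s t Q := by
  induction vs generalizing s t P Q with
  | nil =>
    have e : s.addArc f [u] [] = s := by simp [Mem.addArc]
    rw [e] at h
    simp only [fillHeadP, sat_bind, sat_instr, Instr.exec, PMF.mem_support_pure_iff, forall_eq,
      sat_pure]
    exact h _ _ hP (by simp)
  | cons v vs ih =>
    rw [List.nodup_cons] at hvs
    set s₁ : Mem V m := { s with
      bucket := Function.update s.bucket u
        (Function.update (s.bucket u) v (f :: s.bucket u v)) } with hs₁
    have hb : ∀ u' v', s₁.bucket u' v' =
        if u' = u ∧ v' = v then f :: s.bucket u v else s.bucket u' v' := by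
      intro u' v'
      by_cases hu : u' = u
      · subst hu
        by_cases hv : v' = v
        · subst hv; simp [hs₁]
        · simp [hs₁, hv]
      · simp [hs₁, hu]
    have e : s₁.addArc f [u] vs = s.addArc f [u] (v :: vs) := by
      refine Mem.ext_of_bucket rfl rfl rfl rfl fun u' v' => ?_
      simp only [Mem.addArc, hb, List.mem_cons]
      by_cases hu : u' = u
      · subst hu
        by_cases hv : v' = v
        · subst hv; simp [hvs.1]
        · simp [hv]
      · simp [hu]
    simp only [fillHeadP, sat_bind, sat_instr, Instr.exec, PMF.mem_support_pure_iff, forall_eq,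
      sat_ite, List.isEmpty_iff]
    refine ⟨fun hA => ?_, fun hA => ?_⟩
    · refine ih (s := s₁) hvs.2 ⟨List.nodup_cons.2 ⟨fun h' => (hP.2 _).1 h' hA, hP.1⟩, ?_⟩
        fun P' t' hP' ht' => ?_
      · rintro ⟨u', v'⟩
        simp only [List.mem_cons, hP.2, hb, Prod.mk.injEq]
        by_cases huv : u' = u ∧ v' = v
        · simp [huv]
        · simp [huv]
      · rw [e] at hP' ⊢
        exact h _ _ hP' (by simp; omega)
    · refine ih (s := s₁) hvs.2 ⟨hP.1, ?_⟩ fun P' t' hP' ht' => ?_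
      · rintro ⟨u', v'⟩
        simp only [hP.2, hb]
        by_cases huv : u' = u ∧ v' = v
        · simp [huv, hA]
        · simp [huv]
      · rw [e] at hP' ⊢
        exact h _ _ hP' (by simp; omega)

theorem sat_fillTailP {f : Fin m} {us vs : List V} {P : List (V × V)}
    {Q : List (V × V) → Mem V m → ℕ → Prop} (hus : us.Nodup) (hvs : vs.Nodup)
    (hP : IsBucketIndex s.bucket P)
    (h : ∀ P' t', IsBucketIndex (s.addArc f us vs).bucket P' →
      t' ≤ t + 6 * (us.length * vs.length) + 2 * us.length + 1 → Q P' (s.addArc f us vs) t') :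
    Sat (fillTailP f vs us P) s t Q := by
  induction us generalizing s t P Q with
  | nil =>
    have e : s.addArc f [] vs = s := by simp [Mem.addArc]
    rw [e] at h
    simp only [fillTailP, sat_bind, sat_instr, Instr.exec, PMF.mem_support_pure_iff, forall_eq,
      sat_pure]
    exact h _ _ hP (by simp)
  | cons u us ih =>
    rw [List.nodup_cons] at hus
    have e : (s.addArc f [u] vs).addArc f us vs = s.addArc f (u :: us) vs := by
      refine Mem.ext_of_bucket rfl rfl rfl rfl fun u' v' => ?_
      simp only [Mem.addArc, List.mem_cons]
      by_cases hu : u' = u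
      · subst hu; simp [hus.1]
      · simp [hu]
    simp only [fillTailP, sat_bind, sat_instr, Instr.exec, PMF.mem_support_pure_iff, forall_eq]
    refine sat_fillHeadP hvs hP fun P₁ t₁ hP₁ ht₁ => ih hus.2 hP₁ fun P₂ t₂ hP₂ ht₂ => ?_
    rw [e] at hP₂ ⊢
    refine h _ _ hP₂ ?_
    simp only [List.length_cons, add_mul, one_mul]
    omega

/-- The tails and heads are lists without repetitions, and `ρ` bounds the sizes of the tails and
of the sets `C(f)`. -/
structure Mem.Bounded (s : Mem V m) (ρ : ℕ) : Prop where
  tail_nodup (f : Fin m) : (s.tail f).Nodup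
  head_nodup (f : Fin m) : (s.head f).Nodup
  one_le : 1 ≤ ρ
  tail_le (f : Fin m) : (s.tail f).length ≤ ρ
  prod_le (f : Fin m) : (s.tail f).length * (s.head f).length ≤ ρ

/-- The memory after the members of a list of hyperarcs have been put into the buckets. -/
def Mem.addArcs (s : Mem V m) (F : List (Fin m)) : Mem V m :=
  { s with bucket := fun u v =>
      (F.filter fun f => u ∈ s.tail f ∧ v ∈ s.head f).reverse ++ s.bucket u v }

/-- One hyperarc costs at most `6 |C(f)| + 2 |t(f)| + 4 ≤ 12 ρ`, the constant being absorbed by `1 ≤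
ρ`. -/
theorem sat_fillP {ρ : ℕ} {F : List (Fin m)} {P : List (V × V)}
    {Q : List (V × V) → Mem V m → ℕ → Prop} (hs : s.Bounded ρ)
    (hP : IsBucketIndex s.bucket P)
    (h : ∀ P' t', IsBucketIndex (s.addArcs F).bucket P' → t' ≤ t + 12 * (ρ * F.length) + 1 →
      Q P' (s.addArcs F) t') :
    Sat (fillP F P) s t Q := by
  induction F generalizing s t P Q with
  | nil =>
    have e : s.addArcs [] = s := by simp [Mem.addArcs]
    rw [e] at h
    simp only [fillP, sat_bind, sat_instr, Instr.exec, PMF.mem_support_pure_iff, forall_eq,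
      sat_pure]
    exact h _ _ hP (by simp)
  | cons f F ih =>
    have e : (s.addArc f (s.tail f) (s.head f)).addArcs F = s.addArcs (f :: F) := by
      refine Mem.ext_of_bucket rfl rfl rfl rfl fun u v => ?_
      simp only [Mem.addArcs, Mem.addArc, List.filter_cons]
      by_cases huv : u ∈ s.tail f ∧ v ∈ s.head f
      · simp only [huv, and_self, if_true, decide_true, List.reverse_cons, List.append_assoc,
          List.cons_append, List.nil_append]
        rfl
      · simp only [huv, if_false, decide_false, Bool.false_eq_true]
        rfl
    simp only [fillP, sat_bind, sat_instr, Instr.exec, PMF.mem_support_pure_iff, forall_eq]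
    refine sat_fillTailP (hs.tail_nodup f) (hs.head_nodup f) hP fun P₁ t₁ hP₁ ht₁ =>
      ih ⟨hs.tail_nodup, hs.head_nodup, hs.one_le, hs.tail_le, hs.prod_le⟩ hP₁
        fun P₂ t₂ hP₂ ht₂ => ?_
    rw [e] at hP₂ ⊢
    refine h _ _ hP₂ ?_
    have h1 := hs.tail_le f
    have h2 := hs.prod_le f
    have h3 := hs.one_le
    simp only [List.length_cons, mul_add, mul_one]
    omega

/-! ### Marking the coreset. -/

theorem sat_unmarkedP {l : List (Fin m)} {Q : List (Fin m) → Mem V m → ℕ → Prop}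
    (h : ∀ t' ≤ t + 3 * l.length + 1, Q (l.filter fun f => ¬s.mark f) s t') :
    Sat (unmarkedP l) s t Q := by
  induction l generalizing t Q with
  | nil =>
    simp only [unmarkedP, sat_bind, sat_instr, Instr.exec, PMF.mem_support_pure_iff, forall_eq,
      sat_pure]
    exact h _ (by simp)
  | cons f l ih =>
    simp only [unmarkedP, sat_bind, sat_instr, Instr.exec, PMF.mem_support_pure_iff, forall_eq,
      sat_ite, sat_pure]
    refine ih fun t₁ ht₁ => ⟨fun h₁ => ?_, fun h₁ => ?_⟩
    · have := h (t₁ + 1) (by simp; omega)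
      simpa [List.filter_cons, h₁] using this
    · have := h (t₁ + 1 + 1) (by simp; omega)
      simpa [List.filter_cons, h₁] using this

@[simp] theorem sat_markP (l : List (Fin m)) (Q : Unit → Mem V m → ℕ → Prop) :
    Sat (markP l) s t Q ↔
      Q () { s with mark := fun f => if f ∈ l then true else s.mark f } (t + 2 * l.length + 1) := by
  induction l generalizing s t with
  | nil =>
    simp only [markP, sat_bind, sat_instr, Instr.exec, PMF.mem_support_pure_iff, forall_eq,
      sat_pure, List.not_mem_nil, if_false, List.length_nil]
  | cons f l ih =>
    simp only [markP, sat_bind, sat_instr, Instr.exec, PMF.mem_support_pure_iff, forall_eq, ih]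
    have e : (fun g => if g ∈ l then true else Function.update s.mark f true g) =
        fun g => if g ∈ f :: l then true else s.mark g := by
      funext g
      by_cases hg : g = f
      · subst hg; simp
      · simp [hg]
    rw [e, List.length_cons, show t + 1 + 1 + 2 * l.length + 1 = t + 2 * (l.length + 1) + 1 by ring]

/-- The set of the marked hyperarcs. -/
def Mem.marked (s : Mem V m) : Finset (Fin m) := Finset.univ.filter fun f => s.mark f

omit [DecidableEq V] in
theorem card_marked_markP_le (s : Mem V m) (l : List (Fin m)) :
    ({ s with mark := fun f => if f ∈ l then true else s.mark f } : Mem V m).marked.card ≤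
      s.marked.card + l.length := by
  refine (Finset.card_le_card (t := s.marked ∪ l.toFinset) fun f hf => ?_).trans
    ((Finset.card_union_le _ _).trans (Nat.add_le_add_left (List.toFinset_card_le _) _))
  by_cases hl : f ∈ l <;> simp_all [Mem.marked]

/-- The memory with other marks and the buckets of some pairs emptied. -/
def Mem.clear (s : Mem V m) (P : List (V × V)) (mk : Fin m → Bool) : Mem V m :=
  { s with mark := mk, bucket := fun u v => if (u, v) ∈ P then [] else s.bucket u v }

/-- Each pair marks at most `lam` new hyperarcs and costs a constant plus a linear term in the size
of its bucket. The buckets of the listed pairs are empty afterwards, which prepares the next round.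
-/
theorem sat_pairsP {lam : ℕ} {P : List (V × V)} {F : Finset (Fin m)}
    {Q : Unit → Mem V m → ℕ → Prop} (hP : P.Nodup)
    (hb : ∀ u v, (s.bucket u v).Nodup) (hF : ∀ u v, ∀ f ∈ s.bucket u v, f ∈ F)
    (hmk : s.marked ⊆ F)
    (h : ∀ mk t', (s.clear P mk).marked ⊆ F →
      (s.clear P mk).marked.card ≤ s.marked.card + P.length * lam →
      t' ≤ t + 1020 * (P.map fun x => (s.bucket x.1 x.2).length).sum + 10 * P.length + 1 →
      Q () (s.clear P mk) t') :
    Sat (pairsP lam P) s t Q := by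
  induction P generalizing s t Q with
  | nil =>
    have e : s.clear [] s.mark = s := by simp [Mem.clear]
    simp only [pairsP, sat_bind, sat_instr, Instr.exec, PMF.mem_support_pure_iff, forall_eq,
      sat_pure]
    have := h s.mark (t + 1)
    rw [e] at this
    exact this hmk (by simp) (by simp)
  | cons x P ih =>
    rw [List.nodup_cons] at hP
    simp only [pairsP, sat_bind, sat_instr, Instr.exec, PMF.mem_support_pure_iff, forall_eq]
    set s₁ : Mem V m := { s with
      bucket := Function.update s.bucket x.1 (Function.update (s.bucket x.1) x.2 []) } with hs₁
    have hb₁ : ∀ u v, s₁.bucket u v = if (u, v) = x then [] else s.bucket u v := by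
      intro u v
      obtain ⟨a, b⟩ := x
      by_cases hu : u = a
      · subst hu
        by_cases hv : v = b
        · subst hv; simp [hs₁]
        · simp [hs₁, hv]
      · simp [hs₁, hu]
    -- Emptying the bucket of `x` does not change the later ones, since `x` does not recur in `P`;
    -- so the cost can be stated in terms of the initial buckets.
    have hsum : (P.map fun y => (s₁.bucket y.1 y.2).length).sum =
        (P.map fun y => (s.bucket y.1 y.2).length).sum := by
      congr 1
      refine List.map_congr_left fun y hy => ?_
      rw [hb₁, if_neg]
      rintro rfl
      exact hP.1 hy
    refine sat_unmarkedP fun t₁ ht₁ => ?_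
    set B := (s.bucket x.1 x.2).filter fun f => ¬s₁.mark f
    have hBlen : B.length ≤ (s.bucket x.1 x.2).length := List.length_filter_le _ _
    have hBF : ∀ f ∈ B, f ∈ F := fun f hf => hF _ _ f (List.mem_filter.1 hf).1
    -- Both branches mark some list `l ⊆ B` with at most `lam` members; this treats the remainder of
    -- the loop for both at once.
    have key : ∀ l : List (Fin m), l ⊆ B → l.length ≤ lam → l.length ≤ B.length → ∀ t₂,
        t₂ ≤ t₁ + 1015 * B.length + 5 → Sat (markP l) s₁ t₂
          fun _ s' t' => Sat (pairsP lam P) s' t' Q := by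
      intro l hlB hlam hlen t₂ ht₂
      rw [sat_markP]
      refine ih hP.2 ?_ ?_ ?_ fun mk t' h₁ h₂ h₃ => ?_
      · intro u v
        change (s₁.bucket u v).Nodup
        rw [hb₁]
        split_ifs
        · exact List.nodup_nil
        · exact hb u v
      · intro u v f hf
        change f ∈ s₁.bucket u v at hf
        rw [hb₁] at hf
        split_ifs at hf
        · simp at hf
        · exact hF u v f hf
      · intro f hf
        by_cases hl : f ∈ l
        · exact hBF f (hlB hl)
        · refine hmk ?_
          simpa [Mem.marked, hl, hs₁] using hf
      · have e : Mem.clear { s₁ with mark := fun f => if f ∈ l then true else s₁.mark f } P mk =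
            s.clear (x :: P) mk := by
          refine Mem.ext_of_bucket rfl rfl rfl rfl fun u v => ?_
          simp only [Mem.clear, hb₁]
          by_cases h1 : (u, v) = x <;> by_cases h2 : (u, v) ∈ P <;> simp [h1, h2]
        have hc := card_marked_markP_le s₁ l
        rw [e] at h₁ h₂ ⊢
        refine h mk t' h₁ ?_ ?_
        · have : s₁.marked = s.marked := rfl
          rw [this] at hc
          simp only [List.length_cons, add_mul, one_mul]
          omega
        · have h₃ : t' ≤ t₂ + 2 * l.length + 1 +
              1020 * (P.map fun y => (s₁.bucket y.1 y.2).length).sum + 10 * P.length + 1 := h₃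
          rw [hsum] at h₃
          simp only [List.map_cons, List.sum_cons, List.length_cons]
          omega
    simp only [sat_lengthP, sat_ite, decide_eq_true_eq, sat_bind]
    refine ⟨fun hN => ?_, fun hN => ?_⟩
    · exact key B (List.Subset.refl _) hN.le le_rfl _ (by omega)
    · exact sat_heaviestP ((hb _ _).filter _) (not_lt.1 hN) fun S t₂ hS hSlen ht₂ =>
        key S hS hSlen.le (hSlen.trans_le (not_lt.1 hN)) _ (by omega)

/-- The counted pairs are distinct elements of the product list. -/
theorem countP_pairs_le {P : List (V × V)} (hP : P.Nodup) (us vs : List V) :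
    P.countP (fun x => x.1 ∈ us ∧ x.2 ∈ vs) ≤ us.length * vs.length := by
  rw [List.countP_eq_length_filter, ← List.length_product]
  refine ((hP.filter _).subperm fun x hx => ?_).length_le
  have := (List.mem_filter.1 hx).2
  exact List.mem_product.2 (by simpa using this)

/-- Double counting: a hyperarc `f` lies in at most `|C(f)| ≤ ρ` of the listed sets. -/
theorem sum_bucket_length_le {ρ : ℕ} (hs : s.Bounded ρ) {P : List (V × V)} (hP : P.Nodup)
    (F : List (Fin m)) :
    (P.map fun x => (F.filter fun f => x.1 ∈ s.tail f ∧ x.2 ∈ s.head f).length).sum ≤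
      ρ * F.length := by
  induction F with
  | nil => simp
  | cons f F ih =>
    have h1 := (countP_pairs_le hP (s.tail f) (s.head f)).trans (hs.prod_le f)
    have h2 : (P.map fun x =>
        ((f :: F).filter fun f => x.1 ∈ s.tail f ∧ x.2 ∈ s.head f).length).sum =
        P.countP (fun x => x.1 ∈ s.tail f ∧ x.2 ∈ s.head f) +
        (P.map fun x => (F.filter fun f => x.1 ∈ s.tail f ∧ x.2 ∈ s.head f).length).sum := by
      clear h1 ih hP
      induction P with
      | nil => rfl
      | cons x P ih =>
        rw [List.map_cons, List.sum_cons, ih, List.map_cons, List.sum_cons, List.countP_cons,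
          List.filter_cons]
        split_ifs <;> (try simp only [List.length_cons]) <;> omega
    rw [h2, List.length_cons, mul_add, mul_one]
    omega

theorem sat_coresetFinder [Fintype V] {ρ lam : ℕ} {F : List (Fin m)}
    {Q : Unit → Mem V m → ℕ → Prop} (hs : s.Bounded ρ) (hF : F.Nodup)
    (hb : ∀ u v, s.bucket u v = []) (hmk : ∀ f, s.mark f = false)
    (h : ∀ mk t', ({ s with mark := mk } : Mem V m).marked ⊆ F.toFinset →
      ({ s with mark := mk } : Mem V m).marked.card ≤ Fintype.card V ^ 2 * lam →
      t' ≤ t + 1100 * (ρ * F.length) + 2 → Q () { s with mark := mk } t') :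
    Sat (coresetFinder lam F) s t Q := by
  have hmk' : s.marked = ∅ := by simp [Mem.marked, hmk]
  simp only [coresetFinder, sat_bind]
  refine sat_fillP hs ⟨List.nodup_nil, by simp [hb]⟩ fun P t₁ hP ht₁ => ?_
  have hbucket : ∀ u v, (s.addArcs F).bucket u v =
      (F.filter fun f => u ∈ s.tail f ∧ v ∈ s.head f).reverse := by simp [Mem.addArcs, hb]
  refine sat_pairsP hP.1 (F := F.toFinset) ?_ ?_ ?_ fun mk t' h₁ h₂ h₃ => ?_
  · intro u v
    rw [hbucket]
    exact List.nodup_reverse.2 (hF.filter _)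
  · intro u v f hf
    rw [hbucket, List.mem_reverse] at hf
    exact List.mem_toFinset.2 (List.mem_filter.1 hf).1
  · change s.marked ⊆ _
    simp [hmk']
  · have e : (s.addArcs F).clear P mk = { s with mark := mk } := by
      refine Mem.ext_of_bucket rfl rfl rfl rfl fun u v => ?_
      simp only [Mem.clear, hb]
      -- A pair outside `P` has an empty bucket, so after the loop every bucket is empty.
      split_ifs with h
      · rfl
      · by_contra h'
        exact h ((hP.2 _).2 h')
    rw [e] at h₁ h₂ ⊢
    refine h mk t' h₁ (h₂.trans ?_) ?_
    · change s.marked.card + _ ≤ _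
      rw [hmk', Finset.card_empty, zero_add]
      refine Nat.mul_le_mul_right _ ?_
      have := hP.1.length_le_card
      rwa [Fintype.card_prod, ← sq] at this
    · have h4 := sum_bucket_length_le hs hP.1 F
      simp only [hbucket, List.length_reverse] at h₃
      -- Every listed bucket is nonempty, so the constant cost per pair is absorbed by the total
      -- size of the buckets.
      have h5 : P.length ≤ (P.map fun x =>
          (F.filter fun f => x.1 ∈ s.tail f ∧ x.2 ∈ s.head f).length).sum := by
        have : (P.map fun _ => 1).sum ≤ (P.map fun x =>
            (F.filter fun f => x.1 ∈ s.tail f ∧ x.2 ∈ s.head f).length).sum := by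
          refine List.sum_le_sum fun x hx => ?_
          have := (hP.2 x).1 hx
          rw [hbucket, Ne, List.reverse_eq_nil_iff] at this
          exact List.length_pos_iff.2 this
        simpa using this
      omega

end CoresetAnalysis

/-! ## Expectations -/

section Expectation

open scoped ENNReal

/-- The law of total expectation; with values in `ℝ≥0∞` the sums may be interchanged without any
summability condition. -/
theorem PMF.tsum_bind_mul {α β : Type} (μ : PMF α) (f : α → PMF β) (φ : β → ℝ≥0∞) :
    ∑' b, (μ.bind f) b * φ b = ∑' a, μ a * ∑' b, f a b * φ b := by
  simp only [PMF.bind_apply, ← ENNReal.tsum_mul_right, ← ENNReal.tsum_mul_left]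
  rw [ENNReal.tsum_comm]
  simp only [mul_assoc]

theorem PMF.tsum_pure_mul {α : Type} (a : α) (φ : α → ℝ≥0∞) :
    ∑' b, PMF.pure a b * φ b = φ a := by
  rw [tsum_eq_single a fun b hb => by simp [hb]]
  simp

theorem PMF.tsum_map_mul {α β : Type} (μ : PMF α) (f : α → β) (φ : β → ℝ≥0∞) :
    ∑' b, (μ.map f) b * φ b = ∑' a, μ a * φ (f a) := by
  rw [PMF.map, PMF.tsum_bind_mul]
  simp only [Function.comp_apply, PMF.tsum_pure_mul]

variable {V : Type} [DecidableEq V] {m : ℕ} {α β : Type} {s : Mem V m} {t : ℕ}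

/-- The expectation of `φ` at the end of `p`, started on `s` at time `t`. -/
noncomputable def Ex (p : Prog V m α) (s : Mem V m) (t : ℕ) (φ : α → Mem V m → ℕ → ℝ≥0∞) :
    ℝ≥0∞ :=
  ∑' q, p.run s q * φ q.1 q.2.1 (t + q.2.2)

@[simp] theorem ex_pure (a : α) (φ : α → Mem V m → ℕ → ℝ≥0∞) :
    Ex (pure a) s t φ = φ a s t := by
  change Ex (Prog.ret a) s t φ = _
  rw [Ex, Prog.run, PMF.tsum_pure_mul]
  rfl

theorem ex_bind (p : Prog V m α) (f : α → Prog V m β) (φ : β → Mem V m → ℕ → ℝ≥0∞) :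
    Ex (p >>= f) s t φ = Ex p s t fun a s' t' => Ex (f a) s' t' φ := by
  simp only [Ex, Prog.run_bind, PMF.tsum_bind_mul, PMF.tsum_map_mul, add_assoc]

theorem ex_instr (i : Instr V m α) (φ : α → Mem V m → ℕ → ℝ≥0∞) :
    Ex (instr i) s t φ = ∑' x, i.exec s x * φ x.1 x.2 (t + 1) := by
  rw [Ex, Prog.run_instr, PMF.tsum_map_mul]

theorem ex_coin (φ : Bool → Mem V m → ℕ → ℝ≥0∞) :
    Ex (instr .coin) s t φ = (φ true s (t + 1) + φ false s (t + 1)) * 2⁻¹ := by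
  rw [ex_instr, Instr.exec, PMF.tsum_map_mul, tsum_fintype]
  simp [mul_add, mul_comm]

theorem ex_mono {p : Prog V m α} {Q : α → Mem V m → ℕ → Prop} (hp : Sat p s t Q)
    {φ ψ : α → Mem V m → ℕ → ℝ≥0∞} (h : ∀ a s' t', Q a s' t' → φ a s' t' ≤ ψ a s' t') :
    Ex p s t φ ≤ Ex p s t ψ := by
  refine ENNReal.tsum_le_tsum fun q => ?_
  by_cases hq : q ∈ (p.run s).support
  · exact mul_le_mul_right (h _ _ _ (hp q hq)) _
  · rw [PMF.mem_support_iff, not_not] at hq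
    simp [hq]

@[simp] theorem ex_const (p : Prog V m α) (c : ℝ≥0∞) : Ex p s t (fun _ _ _ => c) = c := by
  rw [Ex, ENNReal.tsum_mul_right, PMF.tsum_coe, one_mul]

theorem ex_add (p : Prog V m α) (φ ψ : α → Mem V m → ℕ → ℝ≥0∞) :
    Ex p s t (fun a s' t' => φ a s' t' + ψ a s' t') = Ex p s t φ + Ex p s t ψ := by
  simp only [Ex, mul_add, ENNReal.tsum_add]

theorem ex_le_of_sat {p : Prog V m α} {φ : α → Mem V m → ℕ → ℝ≥0∞} {c : ℝ≥0∞}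
    (hp : Sat p s t fun a s' t' => φ a s' t' ≤ c) : Ex p s t φ ≤ c :=
  (ex_mono hp fun _ _ _ h => h).trans_eq (ex_const p c)

end Expectation

/-! ## DH-Onestep -/

section SampleAnalysis

open scoped ENNReal

variable {V : Type} [DecidableEq V] {m : ℕ} {s : Mem V m} {t : ℕ}

theorem sat_sampleP {l : List (Fin m)} (hl : l.Nodup) :
    Sat (sampleP l) s t fun F' s' t' => F'.Sublist l ∧ s'.tail = s.tail ∧ s'.head = s.head ∧
      s'.bucket = s.bucket ∧ (∀ f, s'.mark f = if f ∈ l then false else s.mark f) ∧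
      t' ≤ t + 7 * l.length + 1 := by
  induction l generalizing s t with
  | nil => simp [sampleP, Instr.exec]
  | cons f l ih =>
    rw [List.nodup_cons] at hl
    simp only [sampleP, sat_bind, sat_instr, Instr.exec, PMF.mem_support_pure_iff, forall_eq,
      sat_ite, PMF.support_map, Set.forall_mem_image]
    refine ⟨fun hf => (ih hl.2).mono ?_, fun hf b _ => ⟨fun hb => (ih hl.2).mono ?_,
      fun hb => (ih hl.2).mono ?_⟩⟩
    · rintro F' s' t' ⟨h1, h2, h3, h4, h5, h6⟩
      refine ⟨h1.cons_cons f, h2, h3, h4, fun g => ?_, by simp; omega⟩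
      rw [h5]
      by_cases hg : g = f
      · subst hg; simp
      · simp [hg]
    · rintro F' s' t' ⟨h1, h2, h3, h4, h5, h6⟩
      refine ⟨h1.cons_cons f, h2, h3, h4, fun g => ?_, by simp; omega⟩
      rw [h5]
      by_cases hg : g = f
      · subst hg; simp [hf]
      · simp [hg]
    · rintro F' s' t' ⟨h1, h2, h3, h4, h5, h6⟩
      refine ⟨h1.cons f, h2, h3, h4, fun g => ?_, by simp; omega⟩
      rw [h5]
      by_cases hg : g = f
      · subst hg; simp [hf]
      · simp [hg]

/-- The exponential moment with base 2 factorizes over the hyperarcs: a marked one is kept and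
contributes 2, another one contributes `(2 + 1) / 2`. The factor `c` collects the hyperarcs already
kept. -/
theorem ex_sampleP_le {l : List (Fin m)} (hl : l.Nodup) (c : ℝ≥0∞) :
    Ex (sampleP l) s t (fun F' _ _ => c * 2 ^ F'.length) ≤
      c * 2 ^ l.countP (fun f => s.mark f) * (3 * 2⁻¹) ^ l.countP (fun f => ¬s.mark f) := by
  induction l generalizing s t c with
  | nil =>
    simp only [sampleP, ex_bind]
    refine ex_le_of_sat ?_
    simp [Instr.exec]
  | cons f l ih =>
    rw [List.nodup_cons] at hl
    -- Unsetting the mark of `f` does not affect the remaining counts, as `f` does not recur in `l`.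
    have hcongr : ∀ s' : Mem V m, (∀ g ∈ l, s'.mark g = s.mark g) →
        c * 2 * 2 ^ l.countP (fun f => s'.mark f) * (3 * 2⁻¹) ^ l.countP (fun f => ¬s'.mark f) =
        c * 2 * 2 ^ l.countP (fun f => s.mark f) * (3 * 2⁻¹) ^ l.countP (fun f => ¬s.mark f) := by
      intro s' h
      rw [List.countP_congr (p := fun f => s'.mark f) (q := fun f => s.mark f)
        (fun g hg => by simp [h g hg]),
        List.countP_congr (p := fun f => ¬s'.mark f) (q := fun f => ¬s.mark f)
        (fun g hg => by simp [h g hg])]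
    have hcons : ∀ (s' : Mem V m) (t' : ℕ), Ex (sampleP l >>= fun F' => instr (.cons f F')) s' t'
        (fun F' _ _ => c * 2 ^ F'.length) ≤
        c * 2 * 2 ^ l.countP (fun f => s'.mark f) * (3 * 2⁻¹) ^ l.countP (fun f => ¬s'.mark f) := by
      intro s' t'
      refine le_trans ?_ (ih (s := s') (t := t') hl.2 (c * 2))
      rw [ex_bind]
      refine ex_mono (Q := fun _ _ _ => True) (fun _ _ => trivial) fun F' s₁ t₁ _ => ?_
      rw [ex_instr, Instr.exec, PMF.tsum_pure_mul, List.length_cons, pow_succ', mul_assoc]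
    simp only [sampleP]
    rw [ex_bind]
    refine ex_le_of_sat ?_
    simp only [sat_instr, Instr.exec, PMF.mem_support_pure_iff, forall_eq]
    rw [ex_bind]
    refine ex_le_of_sat ?_
    simp only [sat_instr, Instr.exec, PMF.mem_support_pure_iff, forall_eq]
    split_ifs with hf
    · rw [ex_bind]
      refine ex_le_of_sat ?_
      simp only [sat_instr, Instr.exec, PMF.mem_support_pure_iff, forall_eq]
      refine (hcons _ _).trans ?_
      rw [hcongr]
      · simp [hf, pow_succ']
        exact le_of_eq (by ring)
      · intro g hg
        have : g ≠ f := fun h => hl.1 (h ▸ hg)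
        simp [this]
    · rw [ex_bind, ex_coin]
      simp only [if_true, Bool.false_eq_true, if_false]
      have h1 : ∀ t', Ex (instr (.loadWeight f) >>= fun z => instr (.realMul 2 z) >>= fun z' =>
          instr (.storeWeight f z') >>= fun _ => sampleP l >>= fun F' => instr (.cons f F')) s t'
          (fun F' _ _ => c * 2 ^ F'.length) ≤ c * 2 * 2 ^ l.countP (fun f => s.mark f) *
            (3 * 2⁻¹) ^ l.countP (fun f => ¬s.mark f) := by
        intro t'
        rw [ex_bind]
        refine ex_le_of_sat ?_
        simp only [sat_instr, Instr.exec, PMF.mem_support_pure_iff, forall_eq]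
        rw [ex_bind]
        refine ex_le_of_sat ?_
        simp only [sat_instr, Instr.exec, PMF.mem_support_pure_iff, forall_eq]
        rw [ex_bind]
        refine ex_le_of_sat ?_
        simp only [sat_instr, Instr.exec, PMF.mem_support_pure_iff, forall_eq]
        exact hcons _ _
      refine (mul_le_mul_left (add_le_add (h1 _) (ih hl.2 c)) _).trans ?_
      rw [List.countP_cons_of_neg (by simpa using hf), List.countP_cons_of_pos (by simpa using hf),
        pow_succ]
      exact le_of_eq (by ring)

/-- A tail bound for the number of the kept hyperarcs. -/
theorem exp_mul_pow_le {N a b : ℕ} (hN : 0 < N) (hab : a + b = N) (ha : 8 * a ≤ N) :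
    Real.exp (-(7 / 8 * N * Real.log 2)) * 2 ^ a * (3 / 2) ^ b ≤ 16 / (N : ℝ) := by
  have hN' : (0 : ℝ) < N := by exact_mod_cast hN
  have h2 : (2 : ℝ) ^ a = Real.exp (a * Real.log 2) := by
    rw [Real.exp_nat_mul, Real.exp_log two_pos]
  have h3 : (3 / 2 : ℝ) ^ b ≤ Real.exp (b * (1 / 2)) := by
    rw [Real.exp_nat_mul]
    refine pow_le_pow_left₀ (by norm_num) ?_ _
    have := Real.add_one_le_exp (1 / 2 : ℝ)
    linarith
  have hlog := Real.log_two_gt_d9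
  have hab' : (a : ℝ) + b = N := by exact_mod_cast hab
  have ha' : 8 * (a : ℝ) ≤ N := by exact_mod_cast ha
  calc _ ≤ Real.exp (-(7 / 8 * N * Real.log 2)) * Real.exp (a * Real.log 2) *
        Real.exp (b * (1 / 2)) := by rw [h2]; gcongr
    _ = Real.exp (-(7 / 8 * N * Real.log 2) + a * Real.log 2 + b * (1 / 2)) := by
        rw [Real.exp_add, Real.exp_add]
    -- As `log 2 > 1/2`, the worst case is `a = N/8`, where the exponent is `(7/16 - (3/4) log 2) N
    -- < -N/16`.
    _ ≤ Real.exp (-(N / 16)) := by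
        refine Real.exp_le_exp.2 ?_
        nlinarith
    _ ≤ 16 / (N : ℝ) := by
        rw [Real.exp_neg, show (16 : ℝ) / N = ((N : ℝ) / 16)⁻¹ by rw [inv_div]]
        refine inv_anti₀ (by positivity) ?_
        have := Real.add_one_le_exp ((N : ℝ) / 16)
        linarith

/-- The pointwise inequality behind the Chernoff bound: if `k > 7N/8`, then `2^(k - 7N/8) ≥ 1`. -/
theorem indicator_le_exp_mul_pow (N k : ℕ) :
    (if 8 * k ≤ 7 * N then 0 else 1 : ℝ≥0∞) ≤
      ENNReal.ofReal (Real.exp (-(7 / 8 * N * Real.log 2))) * 2 ^ k := by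
  split_ifs with h
  · exact zero_le
  · have h2 : (2 : ℝ≥0∞) ^ k = ENNReal.ofReal (Real.exp (k * Real.log 2)) := by
      rw [Real.exp_nat_mul, Real.exp_log two_pos, ENNReal.ofReal_pow two_pos.le]
      simp
    rw [h2, ← ENNReal.ofReal_mul (Real.exp_pos _).le, ← Real.exp_add, ENNReal.one_le_ofReal,
      Real.one_le_exp_iff]
    have h' : (7 : ℝ) * N ≤ 8 * k := by exact_mod_cast (not_le.1 h).le
    have := Real.log_pos one_lt_two
    nlinarith

theorem ex_sampleP_indicator_le {l : List (Fin m)} (hl : l.Nodup) (h0 : 0 < l.length)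
    (h8 : 8 * s.marked.card ≤ l.length) :
    Ex (sampleP l) s t (fun F' _ _ => if 8 * F'.length ≤ 7 * l.length then 0 else 1) ≤
      ENNReal.ofReal (16 / l.length) := by
  have hcard : l.countP (fun f => s.mark f) ≤ s.marked.card := by
    rw [List.countP_eq_length_filter, ← List.toFinset_card_of_nodup (hl.filter _)]
    refine Finset.card_le_card fun f hf => ?_
    simpa [Mem.marked] using (List.mem_filter.1 (List.mem_toFinset.1 hf)).2
  calc _ ≤ Ex (sampleP l) s t (fun F' _ _ =>
        ENNReal.ofReal (Real.exp (-(7 / 8 * l.length * Real.log 2))) * 2 ^ F'.length) :=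
        ex_mono (Q := fun _ _ _ => True) (fun _ _ => trivial) fun F' _ _ _ =>
          indicator_le_exp_mul_pow _ _
    _ ≤ _ := ex_sampleP_le hl _
    _ = ENNReal.ofReal (Real.exp (-(7 / 8 * l.length * Real.log 2)) *
          2 ^ l.countP (fun f => s.mark f) * (3 / 2) ^ l.countP (fun f => ¬s.mark f)) := by
        rw [ENNReal.ofReal_mul (by positivity), ENNReal.ofReal_mul (by positivity),
          ENNReal.ofReal_pow (by positivity), ENNReal.ofReal_pow (by positivity),
          ENNReal.ofReal_div_of_pos two_pos]
        simp [div_eq_mul_inv]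
    _ ≤ _ := by
        refine ENNReal.ofReal_le_ofReal (exp_mul_pow_le h0 ?_ (by omega))
        exact countP_not_add (fun f => s.mark f = true) l |>.symm ▸ by simp

end SampleAnalysis

/-! ## DH-Sparsify -/

section SparsifyAnalysis

open scoped ENNReal

variable {V : Type} [Fintype V] [DecidableEq V] {m : ℕ} {s : Mem V m} {t : ℕ}

/-- The number `λ_i`. -/
noncomputable def coresetParameter (C₁ ε mstar : ℝ) (mi : ℕ) : ℕ :=
  ⌈C₁ * (Real.log mi * Real.log mi * Real.log mi) /
    (ε / (4 * (Real.log (mi / mstar) / Real.log (4 / 3) *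
      (Real.log (mi / mstar) / Real.log (4 / 3)))) *
    (ε / (4 * (Real.log (mi / mstar) / Real.log (4 / 3) *
      (Real.log (mi / mstar) / Real.log (4 / 3))))))⌉₊

omit [Fintype V] in
@[simp] theorem sat_lambdaP (C₁ ε mstar : ℝ) (mi : ℕ) (Q : ℕ → Mem V m → ℕ → Prop) :
    Sat (lambdaP C₁ ε mstar mi) s t Q ↔ Q (coresetParameter C₁ ε mstar mi) s (t + 16) := by
  simp only [lambdaP, logRatioP, cubeP, coresetParameter, sat_bind, sat_instr, Instr.exec,
    PMF.mem_support_pure_iff, forall_eq, add_assoc, Nat.reduceAdd]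

/-- The memory between two rounds. -/
structure Mem.IsIdle (s : Mem V m) (ρ : ℕ) : Prop where
  bounded : s.Bounded ρ
  bucket_eq (u v : V) : s.bucket u v = []
  mark_eq (f : Fin m) : s.mark f = false

/-- The potential `128/M - 112/N`, where `M = C₃ m^*` and `N` is the current size, bounds the
probability of exceeding the time `B`. A round uses up at most `16/N` of it, and a shrinkage by the
factor 7/8 turns `112/N` into at least `128/N`. The time budget works likewise: `9600 ρ N` drops by
at least `1200 ρ N`, which pays for the round. -/
theorem ex_sparsifyLoop_le {C₁ C₃ ε mstar : ℝ} {ρ B : ℕ} (hpos : 0 < C₃ * mstar)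
    (hlam : ∀ mi : ℕ, C₃ * mstar ≤ mi →
      8 * (Fintype.card V ^ 2 * coresetParameter C₁ ε mstar mi) ≤ mi)
    (k : ℕ) {F : List (Fin m)} (hF : F.Nodup) (hs : s.IsIdle ρ)
    (hB : t + 9600 * (ρ * F.length) + 10 ≤ B) :
    Ex (sparsifyLoop C₁ C₃ ε mstar k F F.length) s t (fun _ _ t' => if t' ≤ B then 0 else 1) ≤
      if C₃ * mstar ≤ F.length then
        ENNReal.ofReal (128 / (C₃ * mstar) - 112 / F.length) else 0 := by
  induction k generalizing F s t with
  | zero =>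
    refine ex_le_of_sat ?_
    simp only [sparsifyLoop, sat_bind, sat_instr, Instr.exec, PMF.mem_support_pure_iff, forall_eq,
      sat_pure]
    rw [if_pos (by omega)]
    exact zero_le
  | succ k ih =>
    simp only [sparsifyLoop, ex_bind]
    refine ex_le_of_sat ?_
    simp only [sat_instr, Instr.exec, PMF.mem_support_pure_iff, forall_eq]
    refine ex_le_of_sat ?_
    simp only [sat_instr, Instr.exec, PMF.mem_support_pure_iff, forall_eq]
    refine ex_le_of_sat ?_
    simp only [sat_instr, Instr.exec, PMF.mem_support_pure_iff, forall_eq]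
    refine ex_le_of_sat ?_
    simp only [sat_instr, Instr.exec, PMF.mem_support_pure_iff, forall_eq, decide_eq_true_eq]
    split_ifs with hm
    swap
    · rw [ex_pure, if_pos (by omega)]
    set M := C₃ * mstar with hM
    have hN : (0 : ℝ) < F.length := hpos.trans_le hm
    have hN' : 0 < F.length := by exact_mod_cast hN
    have hρN : F.length ≤ ρ * F.length := Nat.le_mul_of_pos_left _ hs.bounded.one_le
    rw [ex_bind]
    refine ex_le_of_sat ?_
    simp only [sat_lambdaP]
    simp only [dhOnestep, ex_bind]
    refine ex_le_of_sat (sat_coresetFinder hs.bounded hF hs.bucket_eq hs.mark_eq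
      fun mk t₁ h₁ h₂ h₃ => ?_)
    set s₁ : Mem V m := { s with mark := mk }
    -- If too many hyperarcs survive, the remaining failure probability is bounded by 1; otherwise
    -- the induction hypothesis applies.
    have hbound : Ex (sampleP F) s₁ t₁ (fun F' s' t' => Ex (lengthP F') s' t' fun mi' s'' t'' =>
        Ex (sparsifyLoop C₁ C₃ ε mstar k F' mi') s'' t'' fun _ _ t' => if t' ≤ B then 0 else 1) ≤
        Ex (sampleP F) s₁ t₁ (fun F' _ _ => (if 8 * F'.length ≤ 7 * F.length then 0 else 1) +
          ENNReal.ofReal (128 / M - 128 / F.length)) := by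
      refine ex_mono (sat_sampleP hF) fun F' s' t' ⟨k1, k2, k3, k4, k5, k6⟩ => ?_
      refine ex_le_of_sat ?_
      rw [sat_lengthP]
      split_ifs with h8
      · rw [zero_add]
        have hmul : 8 * (ρ * F'.length) ≤ 7 * (ρ * F.length) := by nlinarith
        have hlen := k1.length_le
        refine (ih (k1.nodup hF) ⟨⟨?_, ?_, hs.bounded.one_le, ?_, ?_⟩, ?_, ?_⟩ ?_).trans ?_
        · rw [k2]; exact hs.bounded.tail_nodup
        · rw [k3]; exact hs.bounded.head_nodup
        · rw [k2]; exact hs.bounded.tail_le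
        · rw [k2, k3]; exact hs.bounded.prod_le
        · rw [k4]; exact hs.bucket_eq
        · intro f
          rw [k5]
          split_ifs with hf
          · rfl
          · by_contra hmark
            refine hf (List.mem_toFinset.1 (h₁ ?_))
            simpa [Mem.marked] using hmark
        · omega
        · split_ifs with hM'
          · refine ENNReal.ofReal_le_ofReal (sub_le_sub_left ?_ _)
            have h8' : 8 * (F'.length : ℝ) ≤ 7 * F.length := by exact_mod_cast h8
            rw [div_le_div_iff₀ hN (hpos.trans_le hM')]
            linarith
          · exact zero_le
      · refine (ex_mono (Q := fun _ _ _ => True) (fun _ _ => trivial)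
          (ψ := fun _ _ _ => 1) fun _ _ _ _ => ?_).trans (by rw [ex_const]; exact le_self_add)
        split_ifs <;> simp
    refine hbound.trans ?_
    rw [ex_add, ex_const]
    have h8 := hlam _ hm
    refine (add_le_add_left (ex_sampleP_indicator_le hF hN' (by omega)) _).trans ?_
    rw [← ENNReal.ofReal_add (by positivity)]
    -- The balance is `16/N + (128/M - 128/N) = 128/M - 112/N`.
    · exact ENNReal.ofReal_le_ofReal (le_of_eq (by ring))
    · exact sub_nonneg.2 (div_le_div_of_nonneg_left (by norm_num) hpos hm)

theorem ex_dhSparsify_le {C₁ C₃ ε mstar : ℝ} {n ρ : ℕ} (hn : n = Fintype.card V)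
    (hmstar : mstar = n / ε * (n / ε) *
      (Real.log (n / ε) * Real.log (n / ε) * Real.log (n / ε)))
    (hpos : 0 < C₃ * mstar)
    (hlam : ∀ mi : ℕ, C₃ * mstar ≤ mi →
      8 * (n ^ 2 * coresetParameter C₁ ε mstar mi) ≤ mi)
    {F : List (Fin m)} (hF : F.Nodup) (hF0 : F ≠ []) (hs : s.IsIdle ρ) :
    Ex (dhSparsify C₁ C₃ n ε F) s 0
      (fun _ _ t' => if t' ≤ 9700 * (ρ * F.length) then 0 else 1) ≤
      ENNReal.ofReal (128 / (C₃ * mstar)) := by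
  subst hn
  have hN : 0 < F.length := List.length_pos_iff.2 hF0
  have hρN : F.length ≤ ρ * F.length := Nat.le_mul_of_pos_left _ hs.bounded.one_le
  simp only [dhSparsify, ex_bind]
  refine ex_le_of_sat ?_
  rw [sat_lengthP]
  refine ex_le_of_sat ?_
  simp only [targetSizeP, cubeP, sat_bind, sat_instr, Instr.exec, PMF.mem_support_pure_iff,
    forall_eq]
  rw [← hmstar]
  refine ex_le_of_sat ?_
  simp only [logRatioP, sat_bind, sat_instr, Instr.exec, PMF.mem_support_pure_iff, forall_eq]
  refine ex_le_of_sat ?_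
  simp only [sat_instr, Instr.exec, PMF.mem_support_pure_iff, forall_eq]
  refine (ex_sparsifyLoop_le hpos hlam _ hF hs (by omega)).trans ?_
  split_ifs
  · refine ENNReal.ofReal_le_ofReal (sub_le_self _ (by positivity))
  · exact zero_le

end SparsifyAnalysis

/-! ## The size of the coreset -/

section Numerics

open Filter Asymptotics

/-- The seventh power of the logarithm comes from `log³ m_i` and from the factor `log⁴ (m_i / m^*)`
in `1 / ε_i²`. -/
theorem eventually_log_pow_le {c : ℝ} (hc : 0 < c) :
    ∀ᶠ x : ℝ in atTop, (2 * Real.log x + 5) ^ 3 * Real.log x ^ 4 ≤ c * x := by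
  have h := (Real.isLittleO_pow_log_id_atTop (n := 7)).bound (c := c / 27) (by positivity)
  have h5 := Real.tendsto_log_atTop.eventually_ge_atTop 5
  filter_upwards [h, h5, eventually_gt_atTop 0] with x hx hx5 hx0
  have h1 : (2 * Real.log x + 5) ^ 3 ≤ (3 * Real.log x) ^ 3 :=
    pow_le_pow_left₀ (by linarith) (by linarith) _
  rw [Real.norm_of_nonneg (by positivity), id, Real.norm_of_nonneg hx0.le] at hx
  calc _ ≤ (3 * Real.log x) ^ 3 * Real.log x ^ 4 := by gcongr
    _ = 27 * Real.log x ^ 7 := by ring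
    _ ≤ _ := by linarith

theorem three_tenths_le_log_cube {L : ℝ} (hL : Real.log 2 ≤ L) : 3 / 10 ≤ L * L * L := by
  have h1 := Real.log_two_gt_d9
  have h2 : (0.69 : ℝ) ≤ L := by linarith
  calc (3 / 10 : ℝ) ≤ 0.69 * 0.69 * 0.69 := by norm_num
    _ ≤ _ := by gcongr

/-- If `m_i ≥ C₃ m^*` with a large `C₃`, then the coreset contains at most an eighth of the
hyperarcs. -/
theorem exists_forall_coresetParameter_le {C₁ : ℝ} (hC₁ : 0 < C₁) :
    ∃ C₀ : ℝ, 1 ≤ C₀ ∧ ∀ C₃ : ℝ, C₀ ≤ C₃ → ∀ (n : ℕ) (ε : ℝ), 2 ≤ n → 0 < ε → ε < 1 →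
      ∀ mstar : ℝ, mstar = n / ε * (n / ε) *
        (Real.log (n / ε) * Real.log (n / ε) * Real.log (n / ε)) →
      ∀ mi : ℕ, C₃ * mstar ≤ mi → 8 * (n ^ 2 * coresetParameter C₁ ε mstar mi) ≤ mi := by
  set b := Real.log (4 / 3) with hb
  have hb0 : 0 < b := Real.log_pos (by norm_num)
  obtain ⟨X, hX⟩ := eventually_atTop.1
    (eventually_log_pow_le (c := b ^ 4 / (256 * C₁)) (by positivity))
  -- `X` makes the polylogarithm small compared with `x = m_i / m^*`; it depends only on `C₁`. The
  -- bound 100 absorbs the rounding in `λ_i`.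
  refine ⟨max X 100, le_max_of_le_right (by norm_num), ?_⟩
  intro C₃ hC₃ n ε hn hε hε1 mstar hmstar mi hmi
  have hn' : (2 : ℝ) ≤ n := by exact_mod_cast hn
  set q := (n : ℝ) / ε with hq
  set L := Real.log q with hL
  have hnq : (n : ℝ) ≤ q := by
    rw [hq, le_div_iff₀ hε]
    nlinarith
  have hq2 : 2 ≤ q := hn'.trans hnq
  have hL2 : Real.log 2 ≤ L := Real.log_le_log two_pos hq2
  have hL0 : 0 < L := (Real.log_pos one_lt_two).trans_le hL2
  have hcube := three_tenths_le_log_cube hL2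
  have hms : 0 < mstar := by rw [hmstar]; positivity
  set x := (mi : ℝ) / mstar with hx
  have hxC : C₃ ≤ x := (le_div_iff₀ hms).2 hmi
  have hx100 : 100 ≤ x := ((le_max_right _ _).trans hC₃).trans hxC
  have hxX := hX x (((le_max_left _ _).trans hC₃).trans hxC)
  have hlogx : 0 < Real.log x := Real.log_pos (by linarith)
  have hmix : (mi : ℝ) = x * mstar := by rw [hx]; field_simp
  have hLq : L ≤ q := (Real.log_le_sub_one_of_pos (by linarith)).trans (by linarith)
  have hlogm : Real.log mstar ≤ 5 * L := by
    have : mstar ≤ q ^ 5 := by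
      rw [hmstar]
      calc q * q * (L * L * L) ≤ q * q * (q * q * q) := by gcongr
        _ = q ^ 5 := by ring
    calc Real.log mstar ≤ Real.log (q ^ 5) := Real.log_le_log hms this
      _ = 5 * L := by rw [Real.log_pow, hL, Nat.cast_ofNat]
  have hlogmi : Real.log mi = Real.log x + Real.log mstar := by
    rw [hmix, Real.log_mul (by linarith) hms.ne']
  have hlogmi0 : 0 ≤ Real.log mi := Real.log_natCast_nonneg _
  -- Since `2L ≥ 2 log 2 ≥ 1`, the summand `log x` is at most `2 L log x`. This separates `x` from
  -- `L`, whose cube is a factor of `m^*`.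
  have hlogmi' : Real.log mi ≤ (2 * Real.log x + 5) * L := by
    have := Real.log_two_gt_d9
    nlinarith
  have hw : C₁ * (Real.log mi * Real.log mi * Real.log mi) /
      (ε / (4 * (Real.log x / b * (Real.log x / b))) *
      (ε / (4 * (Real.log x / b * (Real.log x / b))))) =
      16 * C₁ * Real.log mi ^ 3 * Real.log x ^ 4 / (b ^ 4 * ε ^ 2) := by
    field_simp
    ring
  have hlam : (coresetParameter C₁ ε mstar mi : ℝ) ≤
      16 * C₁ * Real.log mi ^ 3 * Real.log x ^ 4 / (b ^ 4 * ε ^ 2) + 1 := by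
    rw [coresetParameter, hw]
    exact (Nat.ceil_lt_add_one (by positivity)).le
  have hmain : (n : ℝ) ^ 2 * (16 * C₁ * Real.log mi ^ 3 * Real.log x ^ 4 / (b ^ 4 * ε ^ 2)) ≤
      mi / 16 := by
    have h3 : Real.log mi ^ 3 ≤ ((2 * Real.log x + 5) * L) ^ 3 :=
      pow_le_pow_left₀ hlogmi0 hlogmi' _
    calc _ = 16 * C₁ / b ^ 4 * q ^ 2 * (Real.log mi ^ 3 * Real.log x ^ 4) := by
          rw [hq]; field_simp
      _ ≤ 16 * C₁ / b ^ 4 * q ^ 2 * (((2 * Real.log x + 5) * L) ^ 3 * Real.log x ^ 4) := by gcongr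
      _ = 16 * C₁ / b ^ 4 * q ^ 2 * L ^ 3 * ((2 * Real.log x + 5) ^ 3 * Real.log x ^ 4) := by ring
      _ ≤ 16 * C₁ / b ^ 4 * q ^ 2 * L ^ 3 * (b ^ 4 / (256 * C₁) * x) := by gcongr
      _ = mi / 16 := by
          rw [hmix, hmstar]
          field_simp
          ring
  -- Rounding up adds at most 1 to `λ_i`, hence `n²` in total. Together with `hmain` this gives `8
  -- (1/16 + 1/16) = 1`.
  have hn2 : (n : ℝ) ^ 2 ≤ mi / 16 := by
    have h1 : (n : ℝ) ^ 2 * (3 / 10) ≤ mstar := by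
      rw [hmstar, sq]
      gcongr
    rw [hmix]
    nlinarith
  have : (8 * (n ^ 2 * coresetParameter C₁ ε mstar mi) : ℝ) ≤ mi := by
    have := mul_le_mul_of_nonneg_left hlam (sq_nonneg (n : ℝ))
    linarith
  exact_mod_cast this

end Numerics

/-! ## The running time -/

theorem DirectedHypergraph.Representation.isIdle_initialMem {V : Type} [DecidableEq V]
    {H : DirectedHypergraph V} (R : H.Representation) (hH : H.arcs.Nonempty) :
    R.initialMem.IsIdle (H.rank ^ 2) := by
  have hrank : ∀ f ∈ H.arcs, f.2.card + f.1.card ≤ H.rank := fun f hf =>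
    Finset.le_sup (f := fun f : Finset V × Finset V => f.2.card + f.1.card) hf
  have htail : ∀ i, (R.tail i).length = (R.arc i).1.1.card := fun i => by
    rw [← R.tail_toFinset, List.toFinset_card_of_nodup (R.tail_nodup i)]
  have hhead : ∀ i, (R.head i).length = (R.arc i).1.2.card := fun i => by
    rw [← R.head_toFinset, List.toFinset_card_of_nodup (R.head_nodup i)]
  refine ⟨⟨R.tail_nodup, R.head_nodup, ?_, fun i => ?_, fun i => ?_⟩, fun _ _ => rfl,
    fun _ => rfl⟩
  · obtain ⟨f, hf⟩ := hH
    have h1 := hrank f hf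
    have h2 := (H.tail_nonempty f hf).card_pos
    exact Nat.one_le_pow _ _ (by omega)
  · change (R.tail i).length ≤ _
    have h1 := hrank _ (R.arc i).2
    rw [htail]
    nlinarith
  · change (R.tail i).length * (R.head i).length ≤ _
    have h1 := hrank _ (R.arc i).2
    rw [htail, hhead, sq]
    exact Nat.mul_le_mul (by omega) (by omega)

/-- The expectation of the indicator of a time beyond `B` bounds the probability of the complement
of `S`. -/
theorem one_sub_ex_le_runningTime {V : Type} [Fintype V] [DecidableEq V]
    {H : DirectedHypergraph V} (R : H.Representation) (C₁ C₃ ε : ℝ) (B : ℕ) (S : Set ℕ)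
    (hS : ∀ t ≤ B, t ∈ S) :
    1 - Ex (dhSparsify C₁ C₃ (Fintype.card V) ε (List.finRange H.arcs.card)) R.initialMem 0
      (fun _ _ t => if t ≤ B then 0 else 1) ≤ (runningTime R C₁ C₃ ε).toMeasure S := by
  have hcompl : (runningTime R C₁ C₃ ε).toMeasure Sᶜ ≤
      Ex (dhSparsify C₁ C₃ (Fintype.card V) ε (List.finRange H.arcs.card)) R.initialMem 0
        (fun _ _ t => if t ≤ B then 0 else 1) := by
    rw [PMF.toMeasure_apply _ (MeasurableSet.of_discrete)]
    have : ∀ t, Sᶜ.indicator (runningTime R C₁ C₃ ε) t ≤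
        runningTime R C₁ C₃ ε t * if t ≤ B then 0 else 1 := by
      intro t
      by_cases ht : t ≤ B
      · simp [hS t ht]
      · simp only [ht, if_false, mul_one]
        exact Set.indicator_le_self _ _ _
    refine (ENNReal.tsum_le_tsum this).trans ?_
    rw [runningTime, PMF.tsum_map_mul, Ex]
    simp only [zero_add, le_refl]
  refine (tsub_le_tsub_left hcompl _).trans ?_
  rw [tsub_le_iff_right, MeasureTheory.prob_add_prob_compl MeasurableSet.of_discrete]

theorem mainTheorem5 :
    ∃ K : ℝ, 0 < K ∧ ∀ C₁ : ℝ, 0 < C₁ → ∃ C₀ : ℝ, ∀ C₃ : ℝ, C₀ ≤ C₃ →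
      ∀ (V : Type) [Fintype V] [DecidableEq V] (H : DirectedHypergraph V) (R : H.Representation)
        (ε : ℝ), H.arcs.Nonempty → 0 < ε → ε < 1 →
        ENNReal.ofReal (1 - K / (Fintype.card V : ℝ)) ≤
          (runningTime R C₁ C₃ ε).toMeasure
            {t : ℕ | (t : ℝ) ≤ K * (H.rank : ℝ) ^ 2 * (H.arcs.card : ℝ)} := by
  -- The time bound dictates this constant; the failure probability needs only `128 / (3/10) < 427`.
  refine ⟨9700, by norm_num, fun C₁ hC₁ => ?_⟩
  obtain ⟨C₀, hC₀1, hC₀⟩ := exists_forall_coresetParameter_le hC₁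
  refine ⟨C₀, fun C₃ hC₃ V _ _ H R ε hH hε hε1 => ?_⟩
  set n := Fintype.card V with hn
  -- For a single vertex, `log (n / ε)` has no positive lower bound, but then the claimed
  -- probability `1 - K/n` is negative. There is at least one vertex because tails are nonempty.
  rcases lt_or_ge n 2 with hn2 | hn2
  · have hn0 : 0 < n := by
      obtain ⟨f, hf⟩ := hH
      obtain ⟨v, -⟩ := H.tail_nonempty f hf
      exact Fintype.card_pos_iff.2 ⟨v⟩
    have : n = 1 := by omega
    rw [this, ENNReal.ofReal_of_nonpos (by norm_num)]
    exact zero_le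
  have hn2' : (2 : ℝ) ≤ n := by exact_mod_cast hn2
  obtain ⟨mstar, hmstar⟩ : ∃ x : ℝ, x = n / ε * (n / ε) *
    (Real.log (n / ε) * Real.log (n / ε) * Real.log (n / ε)) := ⟨_, rfl⟩
  have hnε : (n : ℝ) ≤ n / ε := by
    rw [le_div_iff₀ hε]
    nlinarith
  have hcube := three_tenths_le_log_cube (Real.log_le_log two_pos (hn2'.trans hnε))
  have hms : (n : ℝ) * (3 / 10) ≤ mstar := by
    rw [hmstar]
    calc (n : ℝ) * (3 / 10) ≤ n / ε * (n / ε) * (3 / 10) := by gcongr; nlinarith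
      _ ≤ _ := by gcongr
  have hCm : mstar ≤ C₃ * mstar := le_mul_of_one_le_left (by linarith) (hC₀1.trans hC₃)
  have hE := ex_dhSparsify_le (n := n) (F := List.finRange H.arcs.card) hn hmstar (by linarith)
    (hC₀ C₃ hC₃ n ε hn2 hε hε1 mstar hmstar) (List.nodup_finRange _)
    (by simpa [List.finRange_eq_nil_iff] using hH.ne_empty) (R.isIdle_initialMem hH)
  refine le_trans ?_ (one_sub_ex_le_runningTime R C₁ C₃ ε
    (9700 * (H.rank ^ 2 * (List.finRange H.arcs.card).length)) _ fun t ht => ?_)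
  · refine le_trans ?_ (tsub_le_tsub_left hE 1)
    rw [ENNReal.ofReal_sub _ (by positivity), ENNReal.ofReal_one]
    refine tsub_le_tsub_left (ENNReal.ofReal_le_ofReal ?_) _
    rw [div_le_div_iff₀ (by linarith) (by linarith)]
    nlinarith
  · rw [List.length_finRange, ← mul_assoc] at ht
    exact_mod_cast ht
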